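/- Let $G=(V,E)$ be a finite complete graph with two distinct vertices $s,t\in V$ and an edge cost $c:E\to\mathbb{R}_{\ge 0}$ satisfying the triangle inequality. For $U\subseteq V$ let $\delta(U)$ be the set of edges with exactly one end in $U$; for $x\in\mathbb{R}^E$ and $F\subseteq E$ write $x(F)=\sum_{e\in F}x_e$ and $c(x)=\sum_{e\in E}x_e\,c(e)$. The path-variant Held–Karp relaxation is the linear program: minimize $c(x)$ subject to $x(\delta(S))\ge 1$ for all $S\subsetneq V$ with $|\{s,t\}\cap S|=1$; $x(\delta(S))\ge 2$ for all $\emptyset\ne S\subsetneq V$ with $|\{s,t\}\cap S|\ne 1$; $x(\delta(\{s\}))=x(\delta(\{t\}))=1$; $x(\delta(\{v\}))=2$ for all $v\in V\setminus\{s,t\}$; and $x\ge 0$. Hoogeveen's algorithm does the following, with ties and choices resolved arbitrarily: (1) find a minimum spanning tree $H$ of $G$; (2) let $T$ be the set of those vertices in $V\setminus\{s,t\}$ that have odd degree in $H$ together with those vertices in $\{s,t\}$ that have even degree in $H$; (3) find a minimum-cost perfect matching $M$ on the subgraph of $G$ induced by $T$; (4) take an Eulerian path from $s$ to $t$ in the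 multigraph $H\cup M$ (an edge in both $H$ and $M$ counts twice) and shortcut it, by skipping vertices, to a Hamiltonian path from $s$ to $t$; output that path. Then every step of the algorithm can be carried out, whatever choices were made before; the linear program has an optimal solution; and every output is a Hamiltonian path from $s$ to $t$ whose cost is at most $\frac53\,c(x^*)$ for every optimal solution $x^*$ of the linear program. Consequently, the algorithm has approximation ratio $\frac53$, i.e. the cost of every output is at most $\frac53$ times the minimum cost of a Hamiltonian path from $s$ to $t$; and the integrality gap of the path-variant Held–Karp relaxation, i.e. the supremum over all such instances of the ratio of the minimum cost of a Hamiltonian path from $s$ to $t$ to the optimal value of the linear program (with $0/0:=0$ and $a/0:=\infty$ for $a>0$), is at most $\frac53$. -/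

import Mathlib

universe u

/-- An instance of the metric traveling salesman path problem on the complete graph with vertex
set `V`: a nonnegative edge cost satisfying the triangle inequality, and two distinct endpoints.
Edges are the non-diagonal elements of `Sym2 V`; values of `c` on the diagonal are never used. -/
structure PathTSP (V : Type u) where
  c : Sym2 V → ℝ
  s : V
  t : V
  s_ne_t : s ≠ t
  nonneg : ∀ u v : V, u ≠ v → 0 ≤ c s(u, v)
  triangle : ∀ u v w : V, u ≠ v → v ≠ w → u ≠ w → c s(u, w) ≤ c s(u, v) + c s(v, w)

namespace PathTSP

section Graph

variable (V : Type u) [Fintype V] [DecidableEq V]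

/-- The edge set `E` of the complete graph on `V`. -/
def edges : Finset (Sym2 V) := (⊤ : SimpleGraph V).edgeFinset

variable {V}

/-- The cut `δ(U) = {e ∈ E : |e ∩ U| = 1}`. -/
def cut (U : Finset V) : Finset (Sym2 V) :=
  (edges V).filter (fun e => (e.toFinset ∩ U).card = 1)

/-- The degree of `v` in the graph with edge set `F`. -/
def deg (F : Finset (Sym2 V)) (v : V) : ℕ := (F.filter (fun e => v ∈ e)).card

/-- `F` is the edge set of a spanning tree of the complete graph on `V`. -/
def IsSpanningTree (F : Finset (Sym2 V)) : Prop :=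
  F ⊆ edges V ∧ (SimpleGraph.fromEdgeSet (F : Set (Sym2 V))).IsTree

/-- `M` is the edge set of a perfect matching on the complete graph `G(T)` induced by `T`. -/
def IsPerfectMatchingOn (T : Finset V) (M : Finset (Sym2 V)) : Prop :=
  M ⊆ edges V ∧ (∀ e ∈ M, ∀ v ∈ e, v ∈ T) ∧ ∀ v ∈ T, ∃! e, e ∈ M ∧ v ∈ e

end Graph

variable {V : Type u} [Fintype V] [DecidableEq V] (I : PathTSP V)

/-- `c(F)`, the cost of an edge set. -/
def setCost (F : Finset (Sym2 V)) : ℝ := ∑ e ∈ F, I.c e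

/-- `c(x) = ∑_{e ∈ E} x_e c(e)`. -/
def lpCost (x : Sym2 V → ℝ) : ℝ := ∑ e ∈ edges V, x e * I.c e

/-- The walks from `s` to `t` in the complete graph. -/
abbrev STWalk : Type u := (⊤ : SimpleGraph V).Walk I.s I.t

/-- The cost of a walk, counting the edges with multiplicity. -/
def walkCost (p : I.STWalk) : ℝ := (p.edges.map I.c).sum

/-- The minimum cost of a Hamiltonian path from `s` to `t`. -/
noncomputable def opt : ℝ := sInf {r | ∃ p : I.STWalk, p.IsHamiltonian ∧ I.walkCost p = r}

/-! ### The path-variant Held-Karp relaxation -/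

/-- Feasibility for the path-variant Held-Karp relaxation. Only the coordinates of `x` indexed by
edges matter. -/
structure HKFeasible (x : Sym2 V → ℝ) : Prop where
  cut_one : ∀ S : Finset V, S ≠ Finset.univ → (({I.s, I.t} : Finset V) ∩ S).card = 1 →
    1 ≤ ∑ e ∈ cut S, x e
  cut_two : ∀ S : Finset V, S ≠ Finset.univ → (({I.s, I.t} : Finset V) ∩ S).card ≠ 1 →
    S ≠ ∅ → 2 ≤ ∑ e ∈ cut S, x e
  deg_s : ∑ e ∈ cut {I.s}, x e = 1
  deg_t : ∑ e ∈ cut {I.t}, x e = 1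
  deg_internal : ∀ v : V, v ≠ I.s → v ≠ I.t → ∑ e ∈ cut {v}, x e = 2
  nonneg : ∀ e ∈ edges V, 0 ≤ x e

/-- `x` is an optimal solution of the path-variant Held-Karp relaxation. -/
def IsHKOptimal (x : Sym2 V → ℝ) : Prop :=
  I.HKFeasible x ∧ ∀ y, I.HKFeasible y → I.lpCost x ≤ I.lpCost y

/-- The optimal value of the path-variant Held-Karp relaxation. -/
noncomputable def hkValue : ℝ := sInf {r | ∃ x, I.HKFeasible x ∧ I.lpCost x = r}

/-! ### Hoogeveen's algorithm with two prespecified endpoints -/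

/-- Step 1: `H` is a minimum spanning tree. -/
def IsMinSpanningTree (H : Finset (Sym2 V)) : Prop :=
  IsSpanningTree H ∧ ∀ H', IsSpanningTree H' → I.setCost H ≤ I.setCost H'

/-- Step 2: the vertices of wrong degree parity in `H`, that is, the endpoints of even degree and
the internal points of odd degree. -/
def wrongParity (H : Finset (Sym2 V)) : Finset V :=
  Finset.univ.filter (fun v =>
    ((v = I.s ∨ v = I.t) ∧ Even (deg H v)) ∨ ((v ≠ I.s ∧ v ≠ I.t) ∧ Odd (deg H v)))

/-- Step 3: `M` is a minimum-cost perfect matching on `G(T)`. -/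
def IsMinMatchingOn (T : Finset V) (M : Finset (Sym2 V)) : Prop :=
  IsPerfectMatchingOn T M ∧ ∀ M', IsPerfectMatchingOn T M' → I.setCost M ≤ I.setCost M'

/-- Step 4a: `p` is an Eulerian path (from `s` to `t`) of the multigraph `H ∪ M`, in which an edge
belonging to both `H` and `M` occurs twice: `p` uses each edge with exactly its multiplicity. -/
def IsEulerianPathOf (H M : Finset (Sym2 V)) (p : I.STWalk) : Prop :=
  (p.edges : Multiset (Sym2 V)) = H.val + M.val

/-- Step 4b: `q` is a Hamiltonian path obtained from `p` by shortcutting, i.e. by skipping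
vertices along `p`. -/
def IsHamiltonianShortcut (p q : I.STWalk) : Prop :=
  q.IsHamiltonian ∧ q.support.Sublist p.support

/-- `q` is a possible output of Hoogeveen's algorithm; the choice of the minimum spanning tree,
the minimum matching, the Eulerian path and the shortcutting is arbitrary. -/
def HoogeveenOutput (q : I.STWalk) : Prop :=
  ∃ H M : Finset (Sym2 V), ∃ p : I.STWalk,
    I.IsMinSpanningTree H ∧ I.IsMinMatchingOn (I.wrongParity H) M ∧
    I.IsEulerianPathOf H M p ∧ I.IsHamiltonianShortcut p q

/-- Every step of Hoogeveen's algorithm can be carried out, whatever choices were made in the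
previous steps. -/
def HoogeveenNeverStuck : Prop :=
  (∃ H, I.IsMinSpanningTree H) ∧
  (∀ H, I.IsMinSpanningTree H → ∃ M, I.IsMinMatchingOn (I.wrongParity H) M) ∧
  (∀ H M, I.IsMinSpanningTree H → I.IsMinMatchingOn (I.wrongParity H) M →
    ∃ p, I.IsEulerianPathOf H M p) ∧
  (∀ H M p, I.IsMinSpanningTree H → I.IsMinMatchingOn (I.wrongParity H) M →
    I.IsEulerianPathOf H M p → ∃ q, I.IsHamiltonianShortcut p q)

end PathTSP

/-- The performance guarantee `ρ` for a (possibly nondeterministic) algorithm `A`, given by the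
relation between instances and possible outputs: on each instance there is an output, and every
output is a Hamiltonian path from `s` to `t` of cost at most `ρ` times the optimum. -/
def IsApproximation (ρ : ℝ)
    (A : ∀ (V : Type u) [Fintype V] [DecidableEq V] (I : PathTSP V), I.STWalk → Prop) : Prop :=
  ∀ (V : Type u) [Fintype V] [DecidableEq V] (I : PathTSP V),
    (∃ q, A V I q) ∧ ∀ q, A V I q → q.IsHamiltonian ∧ I.walkCost q ≤ ρ * I.opt

/-- The integrality gap of the path-variant Held-Karp relaxation: the supremum over all metric
instances of the ratio of the integral optimum to the fractional optimum. In `ℝ≥0∞` the ratio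
`a / 0` is infinite for `a > 0`, and `0 / 0 = 0`. -/
noncomputable def hkIntegralityGap : ENNReal :=
  ⨆ (n : ℕ) (I : PathTSP (Fin n)), ENNReal.ofReal I.opt / ENNReal.ofReal I.hkValue

/-!
The analysis rests on two bounds against a feasible solution `x` of the Held–Karp relaxation, for a
minimum spanning tree `H` and a minimum perfect matching `M` on its vertices of wrong parity:
`c(H) ≤ c(x)` and `3 c(M) ≤ c(H) + c(x)`. Together they give `c(H) + c(M) ≤ 5/3 c(x)`, and
shortcutting an Eulerian path of `H ∪ M` does not raise the cost.

The tree bound (`IsMinSpanningTree.setCost_le`) holds because `x` has value at least `k - 1` across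
every partition of `V` into `k` classes (`HKFeasible.card_sub_one_le`). Subtract the smallest
remaining tree cost from all edges and contract the corresponding tree edge: the tree loses that
amount once per remaining edge, and `x` loses at least as much (`IsSpanningTree.sum_sdiff_le`).

For the matching bound (`IsMinMatchingOn.three_mul_setCost_le`), put `y = (χ_H + x) / 3`. A cut that
splits the set `T` of wrong vertices oddly either does not separate `s` from `t`, and then
`x` is at least `2` on it and `H` contains one of its edges, or it does, and then `H` contains an
even, positive number of its edges. So `y` is at least `1` on all such cuts, and it remains to see
that this implies `c(M) ≤ c(y)` (`exists_matching_le`), a metric form of the Edmonds–Johnson theorem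
on `T`-joins.

That theorem is proved without linear programming duality. Write `τ(T)` for the minimum cost of a
perfect matching on `T` under a pseudometric `D`. Since `T ↦ τ(T)` has an exchange property
(`exists_matchCost_exchange`), a pair `a, b` minimising `τ(T ∆ {a} ∆ {b})` has an end `a` that
is a centre (`exists_center`): the class of points at distance zero from `a` is left exactly once by
every minimum matching on `T`, and no minimum matching passes through `a` otherwise. Shrinking a
small ball of radius `ε` around `a` to a point then lowers `τ(T)` by at most `ε`, but lowers
`D(y) = ∑ y_e D(e)` by at least `ε`, as `y` is at least `1` on the cut of that class. Hence among
the pseudometrics `D' ≤ D` for which `τ(T) - D'(y)` is at least its (supposedly positive) value at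
`D`, which form a compact set, none has a least sum of distances: a contradiction.

The remaining statements use standard arguments: Eulerian walks are obtained by splicing closed
walks, Hamiltonian paths are feasible for the relaxation by counting cut crossings, and the
relaxation attains its optimum by compactness.
-/

set_option linter.unusedSectionVars false

namespace PathTSP

variable {V : Type u} [Fintype V] [DecidableEq V]

open Finset SimpleGraph

/-! ### Cuts and degrees -/

lemma mk_mem_edges {a b : V} : s(a, b) ∈ edges V ↔ a ≠ b := by
  simp [edges]

lemma mk_mem_cut {U : Finset V} {a b : V} : s(a, b) ∈ cut U ↔ ¬ (a ∈ U ↔ b ∈ U) := by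
  rw [cut, mem_filter, mk_mem_edges, Sym2.toFinset_mk_eq]
  by_cases hab : a = b
  · simp [hab]
  by_cases ha : a ∈ U <;> by_cases hb : b ∈ U <;> simp [ha, hb, hab, Finset.insert_inter_of_mem,
    Finset.insert_inter_of_notMem, Finset.singleton_inter_of_mem]

lemma cut_subset_edges (U : Finset V) : cut U ⊆ edges V := filter_subset _ _

lemma mem_cut_singleton {v : V} {e : Sym2 V} : e ∈ cut {v} ↔ e ∈ edges V ∧ v ∈ e := by
  induction e with
  | _ a b =>
    rw [mk_mem_cut, mk_mem_edges, Sym2.mem_iff]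
    grind

lemma cut_univ : cut (univ : Finset V) = ∅ := by
  ext e
  induction e with
  | _ a b => simp [mk_mem_cut]

/-- Handshaking inside `S`: an edge with both ends in `S` contributes two to the degree sum, an edge
of the cut contributes one. -/
lemma sum_deg_mod_two {F : Finset (Sym2 V)} (hF : F ⊆ edges V) (S : Finset V) :
    (∑ v ∈ S, deg F v) ≡ (F ∩ cut S).card [MOD 2] := by
  have h1 : ∑ v ∈ S, deg F v = ∑ e ∈ F, (S.filter (· ∈ e)).card := by
    simp only [deg, card_filter]
    exact sum_comm
  rw [h1, ← filter_mem_eq_inter, card_filter]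
  refine Nat.ModEq.sum (fun e he => ?_)
  have := hF he
  induction e with
  | _ a b =>
    have hab := mk_mem_edges.1 this
    have h2 : S.filter (· ∈ s(a, b)) = ({a, b} : Finset V) ∩ S := by
      ext z; simp [and_comm]
    rw [h2]
    by_cases ha : a ∈ S <;> by_cases hb : b ∈ S <;> simp [ha, hb, hab, mk_mem_cut,
      Finset.insert_inter_of_mem, Finset.insert_inter_of_notMem, Finset.singleton_inter_of_mem,
      Nat.ModEq]

/-! ### Perfect matchings -/

lemma IsPerfectMatchingOn.ne {T : Finset V} {M : Finset (Sym2 V)} (h : IsPerfectMatchingOn T M)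
    {a b : V} (hab : s(a, b) ∈ M) : a ≠ b :=
  mk_mem_edges.1 (h.1 hab)

lemma IsPerfectMatchingOn.exists_partner {T : Finset V} {M : Finset (Sym2 V)}
    (h : IsPerfectMatchingOn T M) {a : V} (ha : a ∈ T) :
    ∃ b ∈ T, a ≠ b ∧ s(a, b) ∈ M := by
  obtain ⟨e, ⟨he, hae⟩, -⟩ := h.2.2 a ha
  obtain ⟨b, rfl⟩ := Sym2.mem_iff_exists.1 hae
  exact ⟨b, h.2.1 _ he b (Sym2.mem_mk_right a b), h.ne he, he⟩

lemma IsPerfectMatchingOn.eq_of_mem {T : Finset V} {M : Finset (Sym2 V)}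
    (h : IsPerfectMatchingOn T M) {e e' : Sym2 V} {a : V} (he : e ∈ M) (he' : e' ∈ M)
    (ha : a ∈ e) (ha' : a ∈ e') : e = e' :=
  (h.2.2 a (h.2.1 e he a ha)).unique ⟨he, ha⟩ ⟨he', ha'⟩

lemma isPerfectMatchingOn_empty : IsPerfectMatchingOn (∅ : Finset V) ∅ := by
  simp [IsPerfectMatchingOn]

lemma IsPerfectMatchingOn.insert {T : Finset V} {M : Finset (Sym2 V)}
    (h : IsPerfectMatchingOn T M) {a b : V} (ha : a ∉ T) (hb : b ∉ T) (hab : a ≠ b) :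
    IsPerfectMatchingOn (insert a (insert b T)) (insert s(a, b) M) := by
  refine ⟨?_, ?_, ?_⟩
  · intro e he
    rcases mem_insert.1 he with rfl | he
    · exact mk_mem_edges.2 hab
    · exact h.1 he
  · intro e he v hv
    rcases mem_insert.1 he with rfl | he
    · rcases Sym2.mem_iff.1 hv with rfl | rfl <;> simp
    · simp [h.2.1 e he v hv]
  · intro v hv
    by_cases hvT : v ∈ T
    · obtain ⟨e, ⟨he, hve⟩, hu⟩ := h.2.2 v hvT
      refine ⟨e, ⟨mem_insert_of_mem he, hve⟩, ?_⟩
      rintro e' ⟨he', hve'⟩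
      rcases mem_insert.1 he' with rfl | he'
      · rcases Sym2.mem_iff.1 hve' with rfl | rfl <;> contradiction
      · exact hu e' ⟨he', hve'⟩
    · refine ⟨s(a, b), ⟨mem_insert_self _ _, ?_⟩, ?_⟩
      · simp only [mem_insert, hvT, or_false] at hv
        exact Sym2.mem_iff.2 hv
      · rintro e' ⟨he', hve'⟩
        rcases mem_insert.1 he' with rfl | he'
        · rfl
        · exact absurd (h.2.1 e' he' v hve') hvT

lemma IsPerfectMatchingOn.erase {T : Finset V} {M : Finset (Sym2 V)}
    (h : IsPerfectMatchingOn T M) {a b : V} (hab : s(a, b) ∈ M) :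
    IsPerfectMatchingOn (T \ {a, b}) (M.erase s(a, b)) := by
  refine ⟨(erase_subset _ _).trans h.1, ?_, ?_⟩
  · intro e he v hv
    obtain ⟨hne, he⟩ := mem_erase.1 he
    rw [mem_sdiff]
    refine ⟨h.2.1 e he v hv, fun hvab => hne ?_⟩
    exact h.eq_of_mem he hab hv (by simpa using hvab)
  · intro v hv
    obtain ⟨hvT, hvab⟩ := mem_sdiff.1 hv
    obtain ⟨e, ⟨he, hve⟩, hu⟩ := h.2.2 v hvT
    refine ⟨e, ⟨mem_erase.2 ⟨?_, he⟩, hve⟩, fun e' he' => hu e' ⟨mem_of_mem_erase he'.1, he'.2⟩⟩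
    rintro rfl
    exact hvab (by simpa using hve)

lemma exists_isPerfectMatchingOn {T : Finset V} (hT : Even T.card) :
    ∃ M, IsPerfectMatchingOn T M := by
  induction hn : T.card using Nat.strong_induction_on generalizing T with
  | _ n ih =>
    subst hn
    rcases T.eq_empty_or_nonempty with rfl | ⟨a, ha⟩
    · exact ⟨∅, isPerfectMatchingOn_empty⟩
    have h2 : (T.erase a).Nonempty := by
      rw [← card_pos, card_erase_of_mem ha]
      have := card_pos.2 ⟨a, ha⟩
      obtain ⟨k, hk⟩ := hT
      omega
    obtain ⟨b, hb⟩ := h2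
    have hc : ((T.erase a).erase b).card = T.card - 2 := by
      rw [card_erase_of_mem hb, card_erase_of_mem ha]; omega
    have hpos := card_pos.2 ⟨a, ha⟩
    obtain ⟨M, hM⟩ := ih ((T.erase a).erase b).card (by omega) (T := (T.erase a).erase b)
      (by rw [hc]; exact hT.tsub even_two) rfl
    have := hM.insert (a := a) (b := b) (by simp) (by simp) (ne_of_mem_erase hb).symm
    rw [insert_erase hb, insert_erase ha] at this
    exact ⟨_, this⟩

lemma IsPerfectMatchingOn.even_card {T : Finset V} {M : Finset (Sym2 V)}
    (h : IsPerfectMatchingOn T M) : Even T.card := by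
  induction hn : M.card using Nat.strong_induction_on generalizing T M with
  | _ n ih =>
    subst hn
    rcases T.eq_empty_or_nonempty with rfl | ⟨a, ha⟩
    · simp
    obtain ⟨b, hb, hne, hab⟩ := h.exists_partner ha
    have h1 := ih _ (card_erase_lt_of_mem hab) (h.erase hab) rfl
    have h2 : (T \ {a, b}).card + 2 = T.card := by
      rw [← card_pair hne]
      exact card_sdiff_add_card_eq_card (by simp [insert_subset_iff, ha, hb])
    rw [← h2]
    exact h1.add even_two

/-- A perfect matching on `T` none of whose edges crosses `S` restricts to `S ∩ T`. -/
lemma IsPerfectMatchingOn.even_inter_of_not_cross {T S : Finset V} {M : Finset (Sym2 V)}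
    (h : IsPerfectMatchingOn T M) (hS : ∀ a b, s(a, b) ∈ M → a ∈ S → b ∈ S) :
    Even (S ∩ T).card := by
  refine IsPerfectMatchingOn.even_card (M := M.filter (fun e => ∀ v ∈ e, v ∈ S)) ⟨?_, ?_, ?_⟩
  · exact (filter_subset _ _).trans h.1
  · intro e he v hv
    obtain ⟨he, heS⟩ := mem_filter.1 he
    exact mem_inter.2 ⟨heS v hv, h.2.1 e he v hv⟩
  · intro v hv
    obtain ⟨hvS, hvT⟩ := mem_inter.1 hv
    obtain ⟨b, hb, hne, hab⟩ := h.exists_partner hvT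
    refine ⟨s(v, b), ⟨mem_filter.2 ⟨hab, ?_⟩, Sym2.mem_mk_left v b⟩, ?_⟩
    · intro w hw
      rcases Sym2.mem_iff.1 hw with rfl | rfl
      · exact hvS
      · exact hS _ _ hab hvS
    · rintro e ⟨he, hve⟩
      exact h.eq_of_mem (mem_filter.1 he).1 hab hve (Sym2.mem_mk_left v b)

/-! ### Minimum matching costs under a pseudometric -/

/-- `D` is a pseudometric on `V`, presented as a function on unordered pairs. -/
structure IsPseudometric (D : Sym2 V → ℝ) : Prop where
  nonneg : ∀ e, 0 ≤ D e
  diag : ∀ v, D s(v, v) = 0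
  triangle : ∀ u v w, D s(u, w) ≤ D s(u, v) + D s(v, w)

/-- The minimum cost of a perfect matching on `T`. It is only meaningful for `T` of even
cardinality, since otherwise there is no perfect matching. -/
noncomputable def matchCost (D : Sym2 V → ℝ) (T : Finset V) : ℝ :=
  sInf {r | ∃ M, IsPerfectMatchingOn T M ∧ ∑ e ∈ M, D e = r}

lemma finite_matchCosts (D : Sym2 V → ℝ) (T : Finset V) :
    {r | ∃ M, IsPerfectMatchingOn T M ∧ ∑ e ∈ M, D e = r}.Finite :=
  ((Set.toFinite {M : Finset (Sym2 V) | IsPerfectMatchingOn T M}).image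
    (fun M => ∑ e ∈ M, D e)).subset (by rintro _ ⟨M, h, rfl⟩; exact ⟨M, h, rfl⟩)

lemma IsPerfectMatchingOn.matchCost_le {T : Finset V} {M : Finset (Sym2 V)}
    (h : IsPerfectMatchingOn T M) (D : Sym2 V → ℝ) : matchCost D T ≤ ∑ e ∈ M, D e :=
  csInf_le (finite_matchCosts D T).bddBelow ⟨M, h, rfl⟩

lemma exists_sum_eq_matchCost (D : Sym2 V → ℝ) {T : Finset V} (hT : Even T.card) :
    ∃ M, IsPerfectMatchingOn T M ∧ ∑ e ∈ M, D e = matchCost D T := by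
  obtain ⟨M, hM⟩ := exists_isPerfectMatchingOn hT
  exact Set.Nonempty.csInf_mem (s := {r | ∃ M, IsPerfectMatchingOn T M ∧ ∑ e ∈ M, D e = r})
    ⟨_, M, hM, rfl⟩ (finite_matchCosts D T)

/-- Change whether `a` belongs to `T`. -/
def toggle (a : V) (T : Finset V) : Finset V := symmDiff T {a}

lemma mem_toggle {a z : V} {T : Finset V} : z ∈ toggle a T ↔ ¬ (z ∈ T ↔ z = a) := by
  simp only [toggle, mem_symmDiff, mem_singleton]; tauto

lemma toggle_comm (a b : V) (T : Finset V) : toggle a (toggle b T) = toggle b (toggle a T) := by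
  simp only [toggle, symmDiff_right_comm]

@[simp] lemma toggle_toggle (a : V) (T : Finset V) : toggle a (toggle a T) = T := by
  simp [toggle]

@[simp] lemma toggle_toggle_cancel (a b : V) (T : Finset V) :
    toggle a (toggle b (toggle a T)) = toggle b T := by
  rw [toggle_comm, toggle_toggle]

lemma card_toggle_mod_two (a : V) (T : Finset V) : Even (toggle a T).card ↔ ¬ Even T.card := by
  by_cases ha : a ∈ T
  · have : toggle a T = T.erase a := by ext z; simp only [mem_toggle, mem_erase]; grind
    rw [this, ← card_erase_add_one ha]
    grind
  · have : toggle a T = Insert.insert a T := by ext z; simp only [mem_toggle, mem_insert]; grind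
    rw [this, card_insert_of_notMem ha]
    grind

lemma even_card_toggle_toggle (a b : V) {T : Finset V} (hT : Even T.card) :
    Even (toggle a (toggle b T)).card := by
  simpa [card_toggle_mod_two] using hT

lemma sdiff_pair_eq_toggle {a b : V} {T : Finset V} (ha : a ∈ T) (hb : b ∈ T) (hab : a ≠ b) :
    T \ {a, b} = toggle a (toggle b T) := by
  ext z; simp only [mem_toggle, mem_sdiff, mem_insert, mem_singleton]; grind

lemma insert_pair_eq_toggle {a b : V} {T : Finset V} (ha : a ∉ T) (hb : b ∉ T) (hab : a ≠ b) :
    Insert.insert a (Insert.insert b T) = toggle a (toggle b T) := by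
  ext z; simp only [mem_toggle, mem_insert]; grind

lemma IsPerfectMatchingOn.erase_toggle {T : Finset V} {M : Finset (Sym2 V)}
    (h : IsPerfectMatchingOn T M) {a b : V} (hab : s(a, b) ∈ M) :
    IsPerfectMatchingOn (toggle a (toggle b T)) (M.erase s(a, b)) := by
  rw [← sdiff_pair_eq_toggle (h.2.1 _ hab a (Sym2.mem_mk_left a b))
    (h.2.1 _ hab b (Sym2.mem_mk_right a b)) (h.ne hab)]
  exact h.erase hab

lemma IsPerfectMatchingOn.matchCost_toggle_add_le {T : Finset V} {M : Finset (Sym2 V)}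
    (h : IsPerfectMatchingOn T M) {a b : V} (hab : s(a, b) ∈ M) (D : Sym2 V → ℝ) :
    matchCost D (toggle a (toggle b T)) + D s(a, b) ≤ ∑ e ∈ M, D e := by
  rw [← sum_erase_add _ _ hab]
  gcongr
  exact (h.erase_toggle hab).matchCost_le D

lemma exists_matchCost_toggle_add_le (D : Sym2 V → ℝ) {T : Finset V} (hT : Even T.card) {a : V}
    (ha : a ∈ T) :
    ∃ b ∈ T, a ≠ b ∧ matchCost D (toggle a (toggle b T)) + D s(a, b) ≤ matchCost D T := by
  obtain ⟨M, hM, hc⟩ := exists_sum_eq_matchCost D hT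
  obtain ⟨b, hb, hne, hab⟩ := hM.exists_partner ha
  exact ⟨b, hb, hne, hc ▸ hM.matchCost_toggle_add_le hab D⟩

lemma matchCost_toggle_le_of_notMem {D : Sym2 V → ℝ} {T : Finset V} (hT : Even T.card)
    {a b : V} (ha : a ∉ T) (hb : b ∉ T) (hab : a ≠ b) :
    matchCost D (toggle a (toggle b T)) ≤ matchCost D T + D s(a, b) := by
  obtain ⟨M, hM, hc⟩ := exists_sum_eq_matchCost D hT
  have h1 := (hM.insert ha hb hab).matchCost_le D
  rw [insert_pair_eq_toggle ha hb hab, sum_insert, hc] at h1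
  · linarith
  · exact fun h => ha (hM.2.1 _ h a (Sym2.mem_mk_left a b))

lemma matchCost_toggle_le_of_mem_of_notMem {D : Sym2 V → ℝ} (hD : IsPseudometric D) {T : Finset V}
    (hT : Even T.card) {a b : V} (ha : a ∈ T) (hb : b ∉ T) :
    matchCost D (toggle a (toggle b T)) ≤ matchCost D T + D s(a, b) := by
  obtain ⟨c, hc, hac, h1⟩ := exists_matchCost_toggle_add_le D hT ha
  have h2 := matchCost_toggle_le_of_notMem (D := D) (a := c) (b := b)
    (even_card_toggle_toggle a c hT)
    (by simp only [mem_toggle]; grind) (by simp only [mem_toggle]; grind) (by grind)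
  have h3 : toggle c (toggle b (toggle a (toggle c T))) = toggle a (toggle b T) := by
    rw [toggle_comm a c, toggle_comm b c, toggle_toggle, toggle_comm]
  rw [h3] at h2
  have := hD.triangle c a b
  rw [Sym2.eq_swap (a := c) (b := a)] at this
  linarith

/-- Subadditivity: prescribing the parity at two further vertices costs at most their
distance. -/
lemma matchCost_toggle_le {D : Sym2 V → ℝ} (hD : IsPseudometric D) {T : Finset V}
    (hT : Even T.card) (a b : V) :
    matchCost D (toggle a (toggle b T)) ≤ matchCost D T + D s(a, b) := by
  by_cases hab : a = b
  · subst hab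
    simp [hD.diag]
  by_cases ha : a ∈ T <;> by_cases hb : b ∈ T
  · obtain ⟨c, hc, hac, h1⟩ := exists_matchCost_toggle_add_le D hT ha
    by_cases hbc : c = b
    · subst hbc
      have := hD.nonneg s(a, c)
      linarith
    have h2 := matchCost_toggle_le_of_mem_of_notMem hD (a := b) (b := c)
      (even_card_toggle_toggle a c hT)
      (by simp only [mem_toggle]; grind) (by simp only [mem_toggle]; grind)
    have h3 : toggle b (toggle c (toggle a (toggle c T))) = toggle a (toggle b T) := by
      rw [toggle_toggle_cancel, toggle_comm]
    rw [h3] at h2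
    have := hD.triangle c a b
    rw [Sym2.eq_swap (a := c) (b := a), Sym2.eq_swap (a := c) (b := b)] at this
    linarith
  · exact matchCost_toggle_le_of_mem_of_notMem hD hT ha hb
  · rw [toggle_comm, Sym2.eq_swap]
    exact matchCost_toggle_le_of_mem_of_notMem hD hT hb ha
  · exact matchCost_toggle_le_of_notMem hT ha hb hab

lemma le_matchCost_toggle_add {D : Sym2 V → ℝ} (hD : IsPseudometric D) {T : Finset V}
    (hT : Even T.card) (a b : V) :
    matchCost D T ≤ matchCost D (toggle a (toggle b T)) + D s(a, b) := by
  have h := matchCost_toggle_le hD (even_card_toggle_toggle a b hT) a b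
  rwa [toggle_comm b a, toggle_toggle, toggle_toggle] at h

/-- The exchange property of minimum matching costs (a valuated delta-matroid): follow the path
that starts at `x` in the union of an optimal matching on `A` and one on `B`. -/
lemma exists_matchCost_exchange {D : Sym2 V → ℝ} (hD : IsPseudometric D) {A B : Finset V}
    (hA : Even A.card) (hB : Even B.card) {x : V} (hx : ¬ (x ∈ A ↔ x ∈ B)) :
    ∃ v, v ≠ x ∧ ¬ (v ∈ A ↔ v ∈ B) ∧
      matchCost D (toggle x (toggle v A)) + matchCost D (toggle x (toggle v B)) ≤
        matchCost D A + matchCost D B := by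
  induction hn : A.card + B.card using Nat.strong_induction_on generalizing A B x with
  | _ n ih =>
    subst hn
    wlog hxA : x ∈ A generalizing A B
    · obtain ⟨v, h1, h2, h3⟩ := this (A := B) (B := A) hB hA (by tauto)
        (fun m hm A' B' hA' hB' x hx h => ih m (by omega) hA' hB' hx h) (by tauto)
      exact ⟨v, h1, by tauto, by linarith⟩
    have hxB : x ∉ B := by tauto
    obtain ⟨w, hwA, hxw, h1⟩ := exists_matchCost_toggle_add_le D hA hxA
    by_cases hwB : w ∈ B
    · have hlt : (toggle x (toggle w A)).card < A.card := by
        rw [← sdiff_pair_eq_toggle hxA hwA hxw]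
        exact card_lt_card (sdiff_ssubset (by simp [insert_subset_iff, hxA, hwA]) (by simp))
      obtain ⟨v, hvw, hv, h2⟩ := ih _ (by omega) (even_card_toggle_toggle x w hA) hB (x := w)
        (by simp only [mem_toggle]; grind) rfl
      refine ⟨v, ?_, ?_, ?_⟩
      · rintro rfl; simp only [mem_toggle] at hv; grind
      · simp only [mem_toggle] at hv; grind
      · have h3 := matchCost_toggle_le hD (even_card_toggle_toggle w v hB) x w
        rw [toggle_comm w v (toggle x (toggle w A))] at h2
        have e1 : toggle v (toggle w (toggle x (toggle w A))) = toggle x (toggle v A) := by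
          rw [toggle_toggle_cancel, toggle_comm]
        have e2 : toggle x (toggle w (toggle w (toggle v B))) = toggle x (toggle v B) := by
          rw [toggle_toggle]
        rw [e1] at h2
        rw [e2] at h3
        linarith
    · refine ⟨w, hxw.symm, by tauto, ?_⟩
      have := matchCost_toggle_le hD hB x w
      linarith

/-! ### Centres of minimum matchings -/

/-- If the pair `x, y` minimises the cost of a matching on `T` with the parities at `x` and `y`
changed, then no pair `u, v` of a minimum matching on `T` has `x` strictly between `u` and `v`.
Otherwise, exchange `x` between `T ∆ {u} ∆ {v}` and `T ∆ {x} ∆ {y}`: each possible partner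
contradicts the choice of `x, y` or the triangle inequality. -/
lemma not_strictly_between {D : Sym2 V → ℝ} (hD : IsPseudometric D) {T : Finset V}
    (hT : Even T.card) {x y : V}
    (hmin : ∀ a b, matchCost D (toggle x (toggle y T)) ≤ matchCost D (toggle a (toggle b T)))
    (hlt : matchCost D (toggle x (toggle y T)) < matchCost D T) {u v : V}
    (hu : 0 < D s(x, u)) (hv : 0 < D s(x, v)) :
    matchCost D T < matchCost D (toggle u (toggle v T)) + (D s(x, u) + D s(x, v)) := by
  by_contra! hle
  have hxy : x ≠ y := by
    rintro rfl
    simp at hlt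
  have hxu : x ≠ u := by rintro rfl; simp [hD.diag] at hu
  have hxv : x ≠ v := by rintro rfl; simp [hD.diag] at hv
  obtain ⟨w, hwx, hw, h1⟩ := exists_matchCost_exchange hD (even_card_toggle_toggle u v hT)
    (even_card_toggle_toggle x y hT) (x := x) (by simp only [mem_toggle]; grind)
  have hw' : w = u ∨ w = v ∨ w = y := by simp only [mem_toggle] at hw; grind
  rcases hw' with rfl | rfl | rfl
  · have e1 : toggle x (toggle w (toggle w (toggle v T))) = toggle x (toggle v T) := by simp
    have e2 : toggle x (toggle w (toggle x (toggle y T))) = toggle w (toggle y T) := by simp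
    have h2 := le_matchCost_toggle_add hD hT x v
    have h3 := hmin w y
    rw [e1, e2] at h1
    linarith
  · have e1 : toggle x (toggle w (toggle u (toggle w T))) = toggle x (toggle u T) := by simp
    have e2 : toggle x (toggle w (toggle x (toggle y T))) = toggle w (toggle y T) := by simp
    have h2 := le_matchCost_toggle_add hD hT x u
    have h3 := hmin w y
    rw [e1, e2] at h1
    linarith
  · have e2 : toggle x (toggle w (toggle x (toggle w T))) = T := by simp
    have h2 := matchCost_toggle_le hD
      (even_card_toggle_toggle x w (even_card_toggle_toggle u v hT)) x v
    have e3 : toggle x (toggle v (toggle x (toggle w (toggle u (toggle v T))))) =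
        toggle u (toggle w T) := by
      rw [toggle_toggle_cancel, toggle_comm u v, toggle_toggle_cancel, toggle_comm]
    rw [e3] at h2
    have h3 := hmin u w
    rw [e2] at h1
    linarith

lemma IsPerfectMatchingOn.matchCost_toggle_toggle_add_le {T : Finset V} {M : Finset (Sym2 V)}
    (h : IsPerfectMatchingOn T M) {a b a' b' : V} (hab : s(a, b) ∈ M) (hab' : s(a', b') ∈ M)
    (hne : s(a, b) ≠ s(a', b')) (D : Sym2 V → ℝ) :
    matchCost D (toggle a' (toggle b' (toggle a (toggle b T)))) + D s(a', b') + D s(a, b) ≤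
      ∑ e ∈ M, D e := by
  rw [← sum_erase_add _ _ hab]
  gcongr
  exact (h.erase_toggle hab).matchCost_toggle_add_le (mem_erase.2 ⟨hne.symm, hab'⟩) D

/-- If matchings on `T` are not free, some vertex `x` is a centre: the set of points at distance
zero from `x` meets `T` in an odd number of points, every minimum matching has at most one edge
leaving that set, and `x` is not strictly between the ends of an edge of a minimum matching. -/
lemma exists_center {D : Sym2 V → ℝ} (hD : IsPseudometric D) {T : Finset V}
    (hT : Even T.card) (hpos : 0 < matchCost D T) :
    ∃ x, Odd ((univ.filter (fun v => D s(x, v) = 0)) ∩ T).card ∧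
      ∀ M, IsPerfectMatchingOn T M → ∑ e ∈ M, D e = matchCost D T →
        (∀ u v, s(u, v) ∈ M → 0 < D s(x, u) → 0 < D s(x, v) →
          D s(u, v) < D s(x, u) + D s(x, v)) ∧
        (∀ u v u' v', s(u, v) ∈ M → s(u', v') ∈ M → D s(x, u) = 0 → D s(x, u') = 0 →
          0 < D s(x, v) → 0 < D s(x, v') → s(u, v) = s(u', v')) := by
  obtain ⟨M₀, hM₀, hc₀⟩ := exists_sum_eq_matchCost D hT
  obtain ⟨e₀, he₀, hpos₀⟩ : ∃ e ∈ M₀, 0 < D e := by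
    by_contra! h
    have := sum_nonpos h
    linarith
  obtain ⟨⟨x, y⟩, -, hmin'⟩ := exists_min_image (univ : Finset (V × V))
    (fun p => matchCost D (toggle p.1 (toggle p.2 T))) (by
      induction e₀ with | _ a b => exact ⟨(a, b), mem_univ _⟩)
  have hmin : ∀ a b, matchCost D (toggle x (toggle y T)) ≤ matchCost D (toggle a (toggle b T)) :=
    fun a b => hmin' (a, b) (mem_univ _)
  have hlt : matchCost D (toggle x (toggle y T)) < matchCost D T := by
    induction e₀ with
    | _ a b =>
      have h1 := hM₀.matchCost_toggle_add_le he₀ D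
      have h2 := hmin a b
      linarith
  have hxy : 0 < D s(x, y) := by
    have h1 := le_matchCost_toggle_add hD hT x y
    linarith
  refine ⟨x, ?_, fun M hM hc => ⟨fun u v huv hu hv => ?_,
    fun u v u' v' huv huv' hu hu' hv hv' => ?_⟩⟩
  · set S := univ.filter (fun v => D s(x, v) = 0) with hS
    rw [← Nat.not_even_iff_odd]
    intro heven
    have hodd : ¬ Even (S ∩ toggle x (toggle y T)).card := by
      have hxS : x ∈ S := by simp [hS, hD.diag]
      have hyS : y ∉ S := by simp [hS, hxy.ne']
      have : S ∩ toggle x (toggle y T) = toggle x (S ∩ T) := by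
        ext z; simp only [mem_inter, mem_toggle]; grind
      rw [this, card_toggle_mod_two, not_not]
      exact heven
    obtain ⟨M, hM, hc⟩ := exists_sum_eq_matchCost D (even_card_toggle_toggle x y hT)
    obtain ⟨a, b, hab, ha, hb⟩ : ∃ a b, s(a, b) ∈ M ∧ a ∈ S ∧ b ∉ S := by
      by_contra! h
      exact hodd (hM.even_inter_of_not_cross h)
    have ha0 : D s(x, a) = 0 := by simpa [hS] using ha
    have hb0 : 0 < D s(x, b) := lt_of_le_of_ne (hD.nonneg _) (Ne.symm (by simpa [hS] using hb))
    have h1 := hM.matchCost_toggle_add_le hab D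
    have h2 := matchCost_toggle_le hD
      (even_card_toggle_toggle a b (even_card_toggle_toggle x y hT)) x a
    have e1 : toggle x (toggle a (toggle a (toggle b (toggle x (toggle y T))))) =
        toggle b (toggle y T) := by simp
    rw [e1] at h2
    have h3 := hmin b y
    have h4 := hD.triangle x a b
    linarith
  · by_contra! hle
    have h1 := not_strictly_between hD hT hmin hlt hu hv
    have h2 := hM.matchCost_toggle_add_le huv D
    linarith
  · -- Two edges leaving the set could be replaced by an edge of cost zero and an edge around `x`.
    by_contra hne
    have h1 := not_strictly_between hD hT hmin hlt hv hv'
    have h2 := hM.matchCost_toggle_toggle_add_le huv huv' hne D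
    have h3 := matchCost_toggle_le hD
      (even_card_toggle_toggle u' v' (even_card_toggle_toggle u v hT)) u u'
    have e1 : toggle u (toggle u' (toggle u' (toggle v' (toggle u (toggle v T))))) =
        toggle v (toggle v' T) := by
      rw [toggle_toggle, toggle_toggle_cancel, toggle_comm]
    rw [e1] at h3
    have h4 := hD.triangle u x u'
    have h5 := hD.triangle x u v
    have h6 := hD.triangle x u' v'
    rw [Sym2.eq_swap (a := u) (b := x)] at h4
    linarith

/-! ### Shrinking a ball -/

/-- The pseudometric obtained from `D` by shrinking the ball of radius `ε` around `x` to a point. -/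
def shrink (D : Sym2 V → ℝ) (x : V) (ε : ℝ) (e : Sym2 V) : ℝ :=
  min (D e) (Sym2.lift ⟨fun u v => max (D s(x, u) - ε) 0 + max (D s(x, v) - ε) 0,
    fun _ _ => add_comm _ _⟩ e)

lemma shrink_mk (D : Sym2 V → ℝ) (x : V) (ε : ℝ) (u v : V) :
    shrink D x ε s(u, v) =
      min (D s(u, v)) (max (D s(x, u) - ε) 0 + max (D s(x, v) - ε) 0) := rfl

lemma shrink_le (D : Sym2 V → ℝ) (x : V) (ε : ℝ) (e : Sym2 V) : shrink D x ε e ≤ D e :=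
  min_le_left _ _

lemma IsPseudometric.shrink {D : Sym2 V → ℝ} (hD : IsPseudometric D) (x : V) (ε : ℝ) :
    IsPseudometric (shrink D x ε) := by
  have hlip : ∀ u v, max (D s(x, u) - ε) 0 ≤ max (D s(x, v) - ε) 0 + D s(u, v) := by
    intro u v
    have h1 := hD.triangle x v u
    rw [Sym2.eq_swap (a := v) (b := u)] at h1
    have h2 := hD.nonneg s(u, v)
    refine max_le ?_ ?_
    · linarith [le_max_left (D s(x, v) - ε) 0]
    · linarith [le_max_right (D s(x, v) - ε) 0]
  refine ⟨?_, ?_, ?_⟩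
  · intro e
    induction e with
    | _ u v =>
      rw [shrink_mk]
      exact le_min (hD.nonneg _) (by positivity)
  · intro v
    rw [shrink_mk, hD.diag]
    exact min_eq_left (by positivity)
  · intro u v w
    simp only [shrink_mk]
    have h1 := hlip u v
    have h2 := hlip w v
    rw [Sym2.eq_swap (a := w) (b := v)] at h2
    have h3 := hD.triangle u v w
    have h4 := le_max_right (D s(x, v) - ε) 0
    have h5 := min_le_left (D s(u, w)) (max (D s(x, u) - ε) 0 + max (D s(x, w) - ε) 0)
    have h6 := min_le_right (D s(u, w)) (max (D s(x, u) - ε) 0 + max (D s(x, w) - ε) 0)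
    rcases min_choice (D s(u, v)) (max (D s(x, u) - ε) 0 + max (D s(x, v) - ε) 0) with h | h <;>
    rcases min_choice (D s(v, w)) (max (D s(x, v) - ε) 0 + max (D s(x, w) - ε) 0) with h' | h' <;>
    · rw [h, h']
      linarith

open Filter Topology in
lemma tendsto_shrink {D : Sym2 V → ℝ} (hD : IsPseudometric D) (x : V) (e : Sym2 V) :
    Tendsto (fun ε => shrink D x ε e) (𝓝[>] 0) (𝓝 (D e)) := by
  have h0 : shrink D x 0 e = D e := by
    induction e with
    | _ u v =>
      rw [shrink_mk, sub_zero, sub_zero, max_eq_left (hD.nonneg _), max_eq_left (hD.nonneg _)]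
      have := hD.triangle u x v
      rw [Sym2.eq_swap (a := u) (b := x)] at this
      exact min_eq_left this
  have hc : Continuous (fun ε => shrink D x ε e) := by
    induction e with
    | _ u v =>
      simp only [shrink_mk]
      fun_prop
  have := (hc.tendsto 0).mono_left (nhdsWithin_le_nhds (s := Set.Ioi 0))
  rwa [h0] at this

/-- Across the zero-distance class of `x`, small shrinkings lower distances by exactly `ε`. -/
lemma shrink_of_zero {D : Sym2 V → ℝ} (hD : IsPseudometric D) {x u v : V} {ε : ℝ} (hε : 0 ≤ ε)
    (hu : D s(x, u) = 0) (hv : ε ≤ D s(x, v)) :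
    shrink D x ε s(u, v) = D s(u, v) - ε := by
  have h1 := hD.triangle x u v
  have h2 := hD.triangle u x v
  rw [Sym2.eq_swap (a := u) (b := x)] at h2
  have h3 : D s(u, v) = D s(x, v) := by linarith
  rw [shrink_mk, hu, h3, max_eq_right (by linarith), max_eq_left (by linarith), zero_add]
  exact min_eq_right (by linarith)

open Filter Topology in
/-- For a centre `x`, a small shrinking lowers the minimum matching cost by at most `ε`. -/
lemma eventually_sub_le_sum_shrink {D : Sym2 V → ℝ} (hD : IsPseudometric D) {T : Finset V} {x : V}
    {M : Finset (Sym2 V)} (hM : IsPerfectMatchingOn T M)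
    (hx : ∑ e ∈ M, D e = matchCost D T →
      (∀ u v, s(u, v) ∈ M → 0 < D s(x, u) → 0 < D s(x, v) → D s(u, v) < D s(x, u) + D s(x, v)) ∧
      (∀ u v u' v', s(u, v) ∈ M → s(u', v') ∈ M → D s(x, u) = 0 → D s(x, u') = 0 →
        0 < D s(x, v) → 0 < D s(x, v') → s(u, v) = s(u', v'))) :
    ∀ᶠ ε in 𝓝[>] (0 : ℝ), matchCost D T - ε ≤ ∑ e ∈ M, shrink D x ε e := by
  have hsmall : ∀ r : ℝ, 0 < r → ∀ᶠ ε in 𝓝[>] (0 : ℝ), ε < r := fun r hr =>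
    nhdsWithin_le_nhds (Iio_mem_nhds hr)
  have hpos : ∀ᶠ ε in 𝓝[>] (0 : ℝ), 0 < ε := self_mem_nhdsWithin
  rcases (hM.matchCost_le D).lt_or_eq with hlt | heq
  · have ht : Tendsto (fun ε => ∑ e ∈ M, shrink D x ε e) (𝓝[>] 0) (𝓝 (∑ e ∈ M, D e)) :=
      tendsto_finsetSum _ (fun e _ => tendsto_shrink hD x e)
    filter_upwards [ht.eventually (lt_mem_nhds hlt), hpos] with ε h1 h2
    linarith
  · obtain ⟨hbetw, hcross⟩ := hx heq.symm
    have hDpos : ∀ v, D s(x, v) ≠ 0 → 0 < D s(x, v) := fun v hv =>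
      lt_of_le_of_ne (hD.nonneg _) hv.symm
    -- Edges that do not cross the class of `x` keep their length.
    have hkeep : ∀ u v, s(u, v) ∈ M → (D s(x, u) = 0 ↔ D s(x, v) = 0) →
        ∀ᶠ ε in 𝓝[>] (0 : ℝ), D s(u, v) ≤ shrink D x ε s(u, v) := by
      intro u v huv hiff
      by_cases hu : D s(x, u) = 0
      · have hv := hiff.1 hu
        have h2 := hD.triangle u x v
        rw [Sym2.eq_swap (a := u) (b := x), hu, hv] at h2
        refine Eventually.of_forall (fun ε => ?_)
        have := (hD.shrink x ε).nonneg s(u, v)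
        linarith
      · have hv : D s(x, v) ≠ 0 := fun h => hu (hiff.2 h)
        have hb := hbetw u v huv (hDpos u hu) (hDpos v hv)
        filter_upwards [hsmall ((D s(x, u) + D s(x, v) - D s(u, v)) / 2) (by linarith)] with ε hε
        rw [shrink_mk]
        refine le_min le_rfl ?_
        linarith [le_max_left (D s(x, u) - ε) 0, le_max_left (D s(x, v) - ε) 0]
    by_cases hex : ∃ u v, s(u, v) ∈ M ∧ D s(x, u) = 0 ∧ D s(x, v) ≠ 0
    · obtain ⟨u, v, huv, hu, hv⟩ := hex
      have hrest : ∀ᶠ ε in 𝓝[>] (0 : ℝ), ∀ e ∈ M.erase s(u, v), D e ≤ shrink D x ε e := by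
        rw [Finset.eventually_all]
        intro e he
        obtain ⟨hne, he⟩ := mem_erase.1 he
        induction e with
        | _ a b =>
          refine hkeep a b he ⟨fun ha => ?_, fun hb => ?_⟩
          · by_contra hb
            exact hne (hcross a b u v he huv ha hu (hDpos b hb) (hDpos v hv))
          · by_contra ha
            rw [Sym2.eq_swap] at he hne
            exact hne (hcross b a u v he huv hb hu (hDpos a ha) (hDpos v hv))
      filter_upwards [hrest, hsmall _ (hDpos v hv), hpos] with ε h1 h2 h3
      rw [heq, ← sum_erase_add _ _ huv, ← sum_erase_add _ (fun e => shrink D x ε e) huv,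
        shrink_of_zero hD h3.le hu h2.le]
      linarith [sum_le_sum h1]
    · push Not at hex
      have hrest : ∀ᶠ ε in 𝓝[>] (0 : ℝ), ∀ e ∈ M, D e ≤ shrink D x ε e := by
        rw [Finset.eventually_all]
        intro e he
        induction e with
        | _ a b =>
          exact hkeep a b he ⟨hex a b he, hex b a (by rwa [Sym2.eq_swap])⟩
      filter_upwards [hrest, hpos] with ε h1 h3
      rw [heq]
      linarith [sum_le_sum h1]

/-- The fractional side: shrinking around `x` lowers the cost of `y` by at least `ε` times the
value of `y` on the cut of the class of `x`. -/
lemma sum_shrink_le {D : Sym2 V → ℝ} (hD : IsPseudometric D) {y : Sym2 V → ℝ}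
    (hy : ∀ e ∈ edges V, 0 ≤ y e) {x : V} {ε : ℝ} (hε : 0 ≤ ε)
    (hsmall : ∀ v, D s(x, v) ≠ 0 → ε ≤ D s(x, v)) :
    ∑ e ∈ edges V, y e * shrink D x ε e ≤ ∑ e ∈ edges V, y e * D e -
      ε * ∑ e ∈ cut (univ.filter (fun v => D s(x, v) = 0)), y e := by
  set S := univ.filter (fun v => D s(x, v) = 0)
  have h1 : ∑ e ∈ cut S, y e = ∑ e ∈ edges V, if e ∈ cut S then y e else 0 := by
    rw [← sum_filter, filter_mem_eq_inter, inter_eq_right.2 (cut_subset_edges S)]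
  rw [h1, mul_sum, ← sum_sub_distrib]
  refine sum_le_sum (fun e he => ?_)
  by_cases hcut : e ∈ cut S
  · rw [if_pos hcut]
    have : shrink D x ε e = D e - ε := by
      induction e with
      | _ u v =>
        rw [mk_mem_cut] at hcut
        simp only [S, mem_filter, mem_univ, true_and] at hcut
        by_cases hu : D s(x, u) = 0
        · exact shrink_of_zero hD hε hu (hsmall v (by tauto))
        · rw [Sym2.eq_swap]
          exact shrink_of_zero hD hε (by tauto) (hsmall u hu)
    rw [this]
    linarith
  · rw [if_neg hcut, mul_zero, sub_zero]
    exact mul_le_mul_of_nonneg_left (shrink_le D x ε e) (hy e he)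

/-- Edmonds–Johnson for pseudometrics: a nonnegative vector with value at least one on every cut
that splits `T` into odd parts costs at least as much as some perfect matching on `T`. -/
theorem exists_matching_le {D : Sym2 V → ℝ} (hD : IsPseudometric D) {T : Finset V}
    (hT : Even T.card) {y : Sym2 V → ℝ} (hy : ∀ e ∈ edges V, 0 ≤ y e)
    (hcut : ∀ S : Finset V, Odd (S ∩ T).card → 1 ≤ ∑ e ∈ cut S, y e) :
    ∃ M, IsPerfectMatchingOn T M ∧ ∑ e ∈ M, D e ≤ ∑ e ∈ edges V, y e * D e := by
  by_contra! hcon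
  obtain ⟨M₀, hM₀, hc₀⟩ := exists_sum_eq_matchCost D hT
  set δ := matchCost D T - ∑ e ∈ edges V, y e * D e with hδ
  have hδpos : 0 < δ := by have := hcon M₀ hM₀; linarith
  -- Among the pseudometrics below `D` violating the claim by at least `δ`, take a least one.
  let K : Set (Sym2 V → ℝ) := {D' | IsPseudometric D' ∧ (∀ e, D' e ≤ D e) ∧
    ∀ M, IsPerfectMatchingOn T M → ∑ e ∈ edges V, y e * D' e + δ ≤ ∑ e ∈ M, D' e}
  have hDK : D ∈ K := ⟨hD, fun _ => le_rfl, fun M hM => by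
    have := hM.matchCost_le D
    linarith⟩
  have hclosed : IsClosed K := by
    have : K = {D' | ∀ e, 0 ≤ D' e} ∩ {D' | ∀ v, D' s(v, v) = 0} ∩
        {D' | ∀ u v w, D' s(u, w) ≤ D' s(u, v) + D' s(v, w)} ∩ {D' | ∀ e, D' e ≤ D e} ∩
        {D' | ∀ M, IsPerfectMatchingOn T M →
          ∑ e ∈ edges V, y e * D' e + δ ≤ ∑ e ∈ M, D' e} := by
      ext D'
      constructor
      · rintro ⟨⟨a, b, c⟩, d, e⟩
        exact ⟨⟨⟨⟨a, b⟩, c⟩, d⟩, e⟩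
      · rintro ⟨⟨⟨⟨a, b⟩, c⟩, d⟩, e⟩
        exact ⟨⟨a, b, c⟩, d, e⟩
    rw [this]
    simp only [Set.ofPred_forall]
    refine IsClosed.inter (IsClosed.inter (IsClosed.inter (IsClosed.inter ?_ ?_) ?_) ?_) ?_
    · exact isClosed_iInter fun e => isClosed_le (by fun_prop) (by fun_prop)
    · exact isClosed_iInter fun v => isClosed_eq (by fun_prop) (by fun_prop)
    · exact isClosed_iInter fun u => isClosed_iInter fun v => isClosed_iInter fun w =>
        isClosed_le (by fun_prop) (by fun_prop)
    · exact isClosed_iInter fun e => isClosed_le (by fun_prop) (by fun_prop)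
    · exact isClosed_iInter fun M => isClosed_iInter fun _ =>
        isClosed_le (by fun_prop) (by fun_prop)
  have hcompact : IsCompact K :=
    IsCompact.of_isClosed_subset
      (isCompact_univ_pi (fun e : Sym2 V => isCompact_Icc (a := (0 : ℝ)) (b := D e))) hclosed
      (fun D' hD' e _ => ⟨hD'.1.nonneg e, hD'.2.1 e⟩)
  obtain ⟨D', hD'K, hmin⟩ := hcompact.exists_isMinOn ⟨D, hDK⟩
    (f := fun D' => ∑ e, D' e) (by fun_prop)
  obtain ⟨hD', hle, hM'⟩ := hD'K
  have hτ : ∑ e ∈ edges V, y e * D' e + δ ≤ matchCost D' T := by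
    obtain ⟨M, hM, hc⟩ := exists_sum_eq_matchCost D' hT
    rw [← hc]
    exact hM' M hM
  have hnn : 0 ≤ ∑ e ∈ edges V, y e * D' e :=
    sum_nonneg (fun e he => mul_nonneg (hy e he) (hD'.nonneg e))
  obtain ⟨x, hodd, hx⟩ := exists_center hD' hT (by linarith)
  have h1 : ∀ᶠ ε in nhdsWithin (0 : ℝ) (Set.Ioi 0), ∀ M, IsPerfectMatchingOn T M →
      matchCost D' T - ε ≤ ∑ e ∈ M, shrink D' x ε e := by
    rw [Filter.eventually_all]
    intro M
    by_cases hM : IsPerfectMatchingOn T M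
    · filter_upwards [eventually_sub_le_sum_shrink hD' hM (hx M hM)] with ε h _
      exact h
    · exact Filter.Eventually.of_forall fun ε h => absurd h hM
  have h2 : ∀ᶠ ε in nhdsWithin (0 : ℝ) (Set.Ioi 0), ∀ v, D' s(x, v) ≠ 0 → ε ≤ D' s(x, v) := by
    rw [Filter.eventually_all]
    intro v
    by_cases hv : D' s(x, v) = 0
    · exact Filter.Eventually.of_forall fun ε h => absurd hv h
    · filter_upwards [nhdsWithin_le_nhds
        (Iio_mem_nhds (lt_of_le_of_ne (hD'.nonneg _) (Ne.symm hv)))] with ε hε _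
      exact hε.le
  obtain ⟨ε, ⟨hε1, hε2⟩, hε⟩ := ((h1.and h2).and self_mem_nhdsWithin).exists
  have hε0 : (0 : ℝ) < ε := hε
  set S := univ.filter (fun v => D' s(x, v) = 0) with hS
  have hyS := hcut S hodd
  have hK : shrink D' x ε ∈ K := by
    refine ⟨hD'.shrink x ε, fun e => (shrink_le _ _ _ e).trans (hle e), fun M hM => ?_⟩
    have h3 := hε1 M hM
    have h4 := sum_shrink_le hD' hy hε0.le hε2
    have h5 : ε * 1 ≤ ε * ∑ e ∈ cut S, y e := by gcongr
    linarith
  have hstrict : ∑ e, shrink D' x ε e < ∑ e, D' e := by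
    refine sum_lt_sum (fun e _ => shrink_le _ _ _ e) ?_
    obtain ⟨a, b, ha, hb⟩ : ∃ a b, a ∈ S ∧ b ∉ S := by
      by_contra! h
      have hxS : x ∈ S := by simp [hS, hD'.diag]
      have : S = univ := by ext b; simpa using h x b hxS
      rw [this, univ_inter, ← Nat.not_even_iff_odd] at hodd
      exact hodd hT
    have ha0 : D' s(x, a) = 0 := by simpa [hS] using ha
    have hb0 : D' s(x, b) ≠ 0 := by simpa [hS] using hb
    refine ⟨s(a, b), mem_univ _, ?_⟩
    rw [shrink_of_zero hD' hε0.le ha0 (hε2 b hb0)]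
    linarith
  exact absurd (hmin hK) (not_le.2 hstrict)

/-! ### Minimum spanning trees against the Held–Karp relaxation -/

lemma IsSpanningTree.exists_mem_cut {H : Finset (Sym2 V)} (hH : IsSpanningTree H) {S : Finset V}
    {a b : V} (ha : a ∈ S) (hb : b ∉ S) : ∃ e ∈ H, e ∈ cut S := by
  obtain ⟨p⟩ := hH.2.connected.preconnected a b
  obtain ⟨d, hd, h1, h2⟩ := p.exists_boundary_dart (S : Set V) (by simpa using ha)
    (by simpa using hb)
  refine ⟨d.edge, ?_, ?_⟩
  · have := d.edge_mem
    rw [edgeSet_fromEdgeSet] at this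
    exact_mod_cast this.1
  · have : d.edge = s(d.fst, d.snd) := rfl
    rw [this, mk_mem_cut]
    simp only [mem_coe] at h1 h2
    tauto

/-- A graph with edge set `F` has at least `|V| - |F|` components. -/
lemma card_le_card_add_card_connectedComponent (F : Finset (Sym2 V)) :
    Fintype.card V ≤ F.card + Nat.card (fromEdgeSet (F : Set (Sym2 V))).ConnectedComponent := by
  classical
  set G := fromEdgeSet (F : Set (Sym2 V)) with hG
  rcases isEmpty_or_nonempty V with hV | ⟨⟨r⟩⟩
  · simp
  have : Fintype G.ConnectedComponent := Fintype.ofFinite _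
  -- Joining one representative of each component to `r` makes the graph connected.
  let C₀ := G.connectedComponentMk r
  let A : Finset (Sym2 V) := (univ.erase C₀).image (fun C => s(C.out, r))
  have hle : G ≤ fromEdgeSet ((F ∪ A : Finset (Sym2 V)) : Set (Sym2 V)) :=
    fromEdgeSet_mono (by simp)
  have hr : ∀ v, (fromEdgeSet ((F ∪ A : Finset (Sym2 V)) : Set (Sym2 V))).Reachable v r := by
    intro v
    by_cases hv : G.connectedComponentMk v = C₀
    · exact (ConnectedComponent.exact hv).mono hle
    · have h1 : G.Reachable v (G.connectedComponentMk v).out :=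
        ConnectedComponent.exact (Quot.out_eq (G.connectedComponentMk v)).symm
      refine (h1.mono hle).trans (Adj.reachable ?_)
      rw [fromEdgeSet_adj]
      refine ⟨?_, ?_⟩
      · simp only [coe_union, Set.mem_union, mem_coe]
        right
        exact mem_image.2 ⟨_, mem_erase.2 ⟨hv, mem_univ _⟩, rfl⟩
      · intro h
        apply hv
        rw [h] at h1
        exact ConnectedComponent.sound h1
  have : Nonempty V := ⟨r⟩
  have hconn : (fromEdgeSet ((F ∪ A : Finset (Sym2 V)) : Set (Sym2 V))).Connected :=
    ⟨fun u v => (hr u).trans (hr v).symm⟩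
  have h1 := hconn.card_vert_le_card_edgeSet_add_one
  have h2 : Nat.card (fromEdgeSet ((F ∪ A : Finset (Sym2 V)) : Set (Sym2 V))).edgeSet ≤
      (F ∪ A).card := by
    rw [edgeSet_fromEdgeSet, Nat.card_coe_set_eq, ← Set.ncard_coe_finset]
    exact Set.ncard_le_ncard Set.sdiff_subset (Set.toFinite _)
  have h3 : A.card ≤ Nat.card G.ConnectedComponent - 1 := by
    refine card_image_le.trans ?_
    rw [card_erase_of_mem (mem_univ _), card_univ, Nat.card_eq_fintype_card]
  have h4 : 0 < Nat.card G.ConnectedComponent := by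
    rw [Nat.card_eq_fintype_card]; exact Fintype.card_pos_iff.2 ⟨C₀⟩
  have h5 := card_union_le F A
  rw [Nat.card_eq_fintype_card] at h1
  omega

lemma IsSpanningTree.card_add_one {H : Finset (Sym2 V)} (hH : IsSpanningTree H) :
    H.card + 1 = Fintype.card V := by
  have h := (isTree_iff_connected_and_card.1 hH.2).2
  have hdiag : Disjoint (H : Set (Sym2 V)) Sym2.diagSet := by
    rw [Set.disjoint_left]
    intro e he hd
    have := hH.1 (by exact_mod_cast he)
    induction e with
    | _ a b => exact mk_mem_edges.1 this (by simpa using hd)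
  rwa [edgeSet_fromEdgeSet, Nat.card_coe_set_eq, hdiag.sdiff_eq_left, Set.ncard_coe_finset,
    Nat.card_eq_fintype_card] at h

open Classical in
/-- The edges joining different components of the graph with edge set `F`. -/
noncomputable def crossing (F : Finset (Sym2 V)) : Finset (Sym2 V) :=
  (edges V).filter
    (fun e => ¬ (e.map (fromEdgeSet (F : Set (Sym2 V))).connectedComponentMk).IsDiag)

lemma mk_mem_crossing {F : Finset (Sym2 V)} {u v : V} :
    s(u, v) ∈ crossing F ↔ ¬ (fromEdgeSet (F : Set (Sym2 V))).Reachable u v := by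
  simp only [crossing, mem_filter, mk_mem_edges, Sym2.map_mk, Sym2.mk_isDiag_iff,
    ConnectedComponent.eq]
  refine ⟨fun h => h.2, fun h => ⟨?_, h⟩⟩
  rintro rfl
  exact h (Reachable.refl u)

lemma crossing_anti {F F' : Finset (Sym2 V)} (h : F ⊆ F') : crossing F' ⊆ crossing F := by
  intro e he
  induction e with
  | _ u v =>
    rw [mk_mem_crossing] at he ⊢
    exact fun h' => he (h'.mono (fromEdgeSet_mono (by exact_mod_cast h)))

lemma IsSpanningTree.exists_separating {H F : Finset (Sym2 V)} (hH : IsSpanningTree H)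
    {u v : V} (huv : ¬ (fromEdgeSet (F : Set (Sym2 V))).Reachable u v) :
    ∃ f ∈ H \ F, ¬ (fromEdgeSet ((H.erase f : Finset (Sym2 V)) : Set (Sym2 V))).Reachable u v := by
  by_contra! hcon
  obtain ⟨p, hp⟩ := (hH.2.connected.preconnected u v).exists_isPath
  refine huv ⟨p.transfer _ (fun e he => ?_)⟩
  have heH := p.edges_subset_edgeSet he
  rw [edgeSet_fromEdgeSet] at heH ⊢
  refine ⟨?_, heH.2⟩
  by_contra heF
  obtain ⟨q, hq⟩ := (hcon e (mem_sdiff.2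
    ⟨by exact_mod_cast heH.1, by exact_mod_cast heF⟩)).exists_isPath
  have hle : fromEdgeSet ((H.erase e : Finset (Sym2 V)) : Set (Sym2 V)) ≤
      fromEdgeSet (H : Set (Sym2 V)) := fromEdgeSet_mono (by simp)
  have h2 : q.mapLe hle = p := congrArg Subtype.val
    ((hH.2.isAcyclic.subsingleton_path u v).elim ⟨q.mapLe hle, hq.mapLe hle⟩ ⟨p, hp⟩)
  rw [← h2, Walk.edges_mapLe_eq_edges] at he
  have := q.edges_subset_edgeSet he
  rw [edgeSet_fromEdgeSet] at this
  simpa using this.1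

lemma IsSpanningTree.exchange {H : Finset (Sym2 V)} (hH : IsSpanningTree H) {f : Sym2 V}
    (hf : f ∈ H) {u v : V}
    (huv : ¬ (fromEdgeSet ((H.erase f : Finset (Sym2 V)) : Set (Sym2 V))).Reachable u v) :
    IsSpanningTree (Insert.insert s(u, v) (H.erase f)) := by
  have hne : u ≠ v := by rintro rfl; exact huv (Reachable.refl u)
  set G := fromEdgeSet ((H.erase f : Finset (Sym2 V)) : Set (Sym2 V)) with hG
  have hG' : fromEdgeSet ((Insert.insert s(u, v) (H.erase f) : Finset (Sym2 V)) : Set (Sym2 V)) =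
      G ⊔ edge u v := by
    rw [coe_insert, Set.insert_eq, Set.union_comm, hG, edge, fromEdgeSet_union]
  refine ⟨?_, ?_, ?_⟩
  · intro e he
    rcases mem_insert.1 he with rfl | he
    · exact mk_mem_edges.2 hne
    · exact hH.1 (mem_of_mem_erase he)
  · rw [hG']
    induction f with
    | _ a b =>
    have key : ∀ {z w : V}, (fromEdgeSet (H : Set (Sym2 V))).Walk z w →
        (G.Reachable w a ∨ G.Reachable w b) → (G.Reachable z a ∨ G.Reachable z b) := by
      intro z w p
      induction p with
      | nil => exact id
      | @cons z z' w h p ih =>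
        intro hw
        by_cases hzz : s(z, z') = s(a, b)
        · rcases Sym2.eq_iff.1 hzz with ⟨rfl, rfl⟩ | ⟨rfl, rfl⟩
          · exact Or.inl (Reachable.refl _)
          · exact Or.inr (Reachable.refl _)
        · have hadj : G.Adj z z' := by
            rw [fromEdgeSet_adj] at h
            rw [hG, fromEdgeSet_adj]
            exact ⟨by simpa [hzz] using h.1, h.2⟩
          rcases ih hw with h' | h'
          · exact Or.inl (hadj.reachable.trans h')
          · exact Or.inr (hadj.reachable.trans h')
    have key' : ∀ z, G.Reachable z a ∨ G.Reachable z b := fun z => by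
      obtain ⟨p⟩ := hH.2.connected.preconnected z a
      exact key p (Or.inl (Reachable.refl _))
    have hle : G ≤ G ⊔ edge u v := le_sup_left
    have hadj : (G ⊔ edge u v).Reachable u v :=
      Adj.reachable (Or.inr (by simp [edge_adj, hne]))
    have hab : (G ⊔ edge u v).Reachable a b := by
      rcases key' u with hu | hu <;> rcases key' v with hv | hv
      · exact absurd (hu.trans hv.symm) huv
      · exact (hu.symm.mono hle).trans (hadj.trans (hv.mono hle))
      · exact (hv.symm.mono hle).trans (hadj.symm.trans (hu.mono hle))
      · exact absurd (hu.trans hv.symm) huv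
    have hall : ∀ z, (G ⊔ edge u v).Reachable z a := fun z => by
      rcases key' z with hz | hz
      · exact hz.mono hle
      · exact (hz.mono hle).trans hab.symm
    have : Nonempty V := ⟨u⟩
    exact ⟨fun z w => (hall z).trans (hall w).symm⟩
  · rw [hG']
    refine IsAcyclic.sup_edge_of_not_reachable huv ?_
    exact hH.2.isAcyclic.anti (fromEdgeSet_mono (by simp))

/-- Greedy bound: if the cost of every edge is at least that of the edges of `H` it could replace,
then `c(H \ F) ≤ c(x)` in the graph with `F` contracted, provided `x` crosses all partitions into
components often enough. The smallest cost remaining in `H \ F` is subtracted from all edges, and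
its edge is contracted. -/
lemma IsSpanningTree.sum_sdiff_le {H : Finset (Sym2 V)} (hH : IsSpanningTree H) {x : Sym2 V → ℝ}
    (hx : ∀ e ∈ edges V, 0 ≤ x e)
    (hcr : ∀ F ⊆ H, ((H \ F).card : ℝ) ≤ ∑ e ∈ crossing F, x e)
    {F : Finset (Sym2 V)} (hF : F ⊆ H) {c : Sym2 V → ℝ} (hc : ∀ f ∈ H \ F, 0 ≤ c f)
    (hdom : ∀ f ∈ H \ F, ∀ u v,
      ¬ (fromEdgeSet ((H.erase f : Finset (Sym2 V)) : Set (Sym2 V))).Reachable u v →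
        c f ≤ c s(u, v)) :
    ∑ f ∈ H \ F, c f ≤ ∑ e ∈ crossing F, x e * c e := by
  have hxc : ∀ F, ∀ e ∈ crossing F, 0 ≤ x e := fun F e he => by
    classical exact hx e (mem_of_mem_filter e he)
  induction hn : (H \ F).card generalizing F c with
  | zero =>
    have hcF : crossing F = ∅ := by
      rw [eq_empty_iff_forall_notMem]
      intro e he
      induction e with
      | _ u v =>
        obtain ⟨f, hf, -⟩ := hH.exists_separating (mk_mem_crossing.1 he)
        rw [card_eq_zero.1 hn] at hf
        simp at hf
    rw [card_eq_zero.1 hn, hcF]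
    simp
  | succ n ih =>
    obtain ⟨f, hf, hmin⟩ := exists_min_image (H \ F) c (card_pos.1 (by omega))
    have hge : ∀ e ∈ crossing F, c f ≤ c e := by
      intro e he
      induction e with
      | _ u v =>
        obtain ⟨g, hg, hsep⟩ := hH.exists_separating (mk_mem_crossing.1 he)
        exact (hmin g hg).trans (hdom g hg u v hsep)
    have hsd : H \ Insert.insert f F = (H \ F).erase f := by
      ext e; simp only [mem_sdiff, mem_insert, mem_erase]; tauto
    have hsub : ∀ g ∈ H \ Insert.insert f F, g ∈ H \ F := fun g hg => by
      rw [hsd] at hg; exact mem_of_mem_erase hg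
    have h1 := ih (F := Insert.insert f F) (c := fun e => c e - c f)
      (insert_subset (mem_sdiff.1 hf).1 hF)
      (fun g hg => sub_nonneg.2 (hmin g (hsub g hg)))
      (fun g hg u v h => by have := hdom g (hsub g hg) u v h; simpa using this)
      (by rw [hsd, card_erase_of_mem hf, hn]; rfl)
    have h2 : ∑ e ∈ crossing (Insert.insert f F), x e * (c e - c f) ≤
        ∑ e ∈ crossing F, x e * (c e - c f) :=
      sum_le_sum_of_subset_of_nonneg (crossing_anti (subset_insert f F))
        (fun e he _ => mul_nonneg (hxc F e he) (sub_nonneg.2 (hge e he)))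
    have h3 : ∑ e ∈ crossing F, x e * (c e - c f) =
        ∑ e ∈ crossing F, x e * c e - c f * ∑ e ∈ crossing F, x e := by
      rw [mul_sum, ← sum_sub_distrib]
      exact sum_congr rfl (fun e _ => by ring)
    have h4 : ∑ g ∈ H \ Insert.insert f F, (c g - c f) =
        ∑ g ∈ H \ F, c g - c f * ((H \ F).card : ℝ) := by
      have : ∑ g ∈ H \ F, (c g - c f) = ∑ g ∈ H \ F, c g - c f * ((H \ F).card : ℝ) := by
        rw [sum_sub_distrib, sum_const, nsmul_eq_mul]; ring
      rw [← this, hsd, ← sum_erase_add _ _ hf, sub_self, add_zero]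
    have h5 := mul_le_mul_of_nonneg_left (hcr F hF) (hc f hf)
    linarith

variable (I : PathTSP V)

variable {I} in
lemma IsMinSpanningTree.le_of_separates {H : Finset (Sym2 V)} (hH : I.IsMinSpanningTree H)
    {f : Sym2 V} (hf : f ∈ H) {u v : V}
    (huv : ¬ (fromEdgeSet ((H.erase f : Finset (Sym2 V)) : Set (Sym2 V))).Reachable u v) :
    I.c f ≤ I.c s(u, v) := by
  have h1 := hH.2 _ (hH.1.exchange hf huv)
  have hnot : s(u, v) ∉ H.erase f := by
    intro h
    have hne : u ≠ v := by rintro rfl; exact huv (Reachable.refl u)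
    exact huv (Adj.reachable ((fromEdgeSet_adj _).2 ⟨by exact_mod_cast h, hne⟩))
  rw [setCost, setCost, sum_insert hnot, ← sum_erase_add _ _ hf] at h1
  linarith

variable {I} in
/-- A feasible `x` crosses every partition of `V` into `k` classes with value at least `k - 1`: sum
the cut constraints of the classes. -/
lemma HKFeasible.card_sub_one_le {x : Sym2 V → ℝ} (hx : I.HKFeasible x) {ι : Type*} [Fintype ι]
    [DecidableEq ι] {p : V → ι} (hp : Function.Surjective p) :
    (Fintype.card ι : ℝ) - 1 ≤ ∑ e ∈ (edges V).filter (fun e => ¬ (e.map p).IsDiag), x e := by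
  by_cases hcard : Fintype.card ι ≤ 1
  · have h1 : (Fintype.card ι : ℝ) ≤ 1 := by exact_mod_cast hcard
    have h2 : 0 ≤ ∑ e ∈ (edges V).filter (fun e => ¬ (e.map p).IsDiag), x e :=
      sum_nonneg (fun e he => hx.nonneg e (mem_of_mem_filter e he))
    linarith
  let S : ι → Finset V := fun i => univ.filter (fun v => p v = i)
  have hdouble : ∑ i, ∑ e ∈ cut (S i), x e =
      2 * ∑ e ∈ (edges V).filter (fun e => ¬ (e.map p).IsDiag), x e := by
    have h1 : ∀ i, ∑ e ∈ cut (S i), x e = ∑ e ∈ edges V, if e ∈ cut (S i) then x e else 0 := by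
      intro i
      rw [← sum_filter, filter_mem_eq_inter, inter_eq_right.2 (cut_subset_edges _)]
    simp only [h1]
    rw [sum_comm, sum_filter, mul_sum]
    refine sum_congr rfl (fun e _ => ?_)
    rw [← sum_filter, sum_const, nsmul_eq_mul]
    induction e with
    | _ u v =>
      simp only [Sym2.map_mk, Sym2.mk_isDiag_iff, mk_mem_cut, S, mem_filter, mem_univ, true_and]
      by_cases huv : p u = p v
      · simp [huv]
      · have : univ.filter (fun i => ¬ (p u = i ↔ p v = i)) = {p u, p v} := by
          ext i; simp only [mem_filter, mem_univ, true_and, mem_insert, mem_singleton]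
          grind
        rw [this, card_pair huv, if_pos huv]
        norm_num
  have hbound : ∀ i, (2 : ℝ) - ((if p I.s = i then 1 else 0) + (if p I.t = i then 1 else 0)) ≤
      ∑ e ∈ cut (S i), x e := by
    intro i
    have hne : S i ≠ univ := by
      intro h
      have : ∀ j, j = i := fun j => by
        obtain ⟨v, rfl⟩ := hp j
        have : v ∈ S i := h ▸ mem_univ v
        simpa [S] using this
      exact hcard (Fintype.card_le_one_iff.2 (fun a b => (this a).trans (this b).symm))
    have hne' : S i ≠ ∅ := by
      obtain ⟨v, hv⟩ := hp i
      exact ne_empty_of_mem (a := v) (by simp [S, hv])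
    have hst := I.s_ne_t
    by_cases hs : p I.s = i <;> by_cases ht : p I.t = i
    · have h := hx.cut_two (S i) hne (by
        rw [inter_eq_left.2 (by simp [insert_subset_iff, S, hs, ht]), card_pair hst]; simp) hne'
      simp only [hs, ht, if_true]; linarith
    · have h := hx.cut_one (S i) hne (by
        rw [insert_inter_of_mem (by simp [S, hs]), singleton_inter_of_notMem (by simp [S, ht])]
        simp)
      simp only [hs, ht, if_true, if_false]; linarith
    · have h := hx.cut_one (S i) hne (by
        rw [insert_inter_of_notMem (by simp [S, hs]), singleton_inter_of_mem (by simp [S, ht])]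
        simp)
      simp only [hs, ht, if_true, if_false]; linarith
    · have h := hx.cut_two (S i) hne (by
        rw [insert_inter_of_notMem (by simp [S, hs]), singleton_inter_of_notMem (by simp [S, ht])]
        simp) hne'
      simp only [hs, ht, if_false]; linarith
  have hsum := sum_le_sum (fun i (_ : i ∈ univ) => hbound i)
  rw [hdouble, sum_sub_distrib, sum_add_distrib] at hsum
  simp only [sum_const, card_univ, nsmul_eq_mul, sum_ite_eq, mem_univ, if_true] at hsum
  linarith

variable {I} in
/-- A minimum spanning tree costs at most as much as any feasible solution of the relaxation. -/
theorem IsMinSpanningTree.setCost_le {H : Finset (Sym2 V)} (hH : I.IsMinSpanningTree H)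
    {x : Sym2 V → ℝ} (hx : I.HKFeasible x) : I.setCost H ≤ I.lpCost x := by
  classical
  have hcr : ∀ F ⊆ H, ((H \ F).card : ℝ) ≤ ∑ e ∈ crossing F, x e := by
    intro F hF
    have : Fintype (fromEdgeSet (F : Set (Sym2 V))).ConnectedComponent := Fintype.ofFinite _
    have h1 := hx.card_sub_one_le
      (p := (fromEdgeSet (F : Set (Sym2 V))).connectedComponentMk) Quot.mk_surjective
    have h2 := card_le_card_add_card_connectedComponent F
    rw [Nat.card_eq_fintype_card] at h2
    have h3 := hH.1.card_add_one
    have h5 := card_sdiff_add_card_eq_card hF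
    have h6 : ((H \ F).card : ℝ) + 1 ≤
        Fintype.card (fromEdgeSet (F : Set (Sym2 V))).ConnectedComponent := by
      exact_mod_cast (by omega)
    rw [crossing]
    convert le_trans (le_sub_iff_add_le.2 h6) h1
  have h := hH.1.sum_sdiff_le hx.nonneg hcr (empty_subset H) (c := I.c)
    (fun f hf => by
      have := hH.1.1 (mem_sdiff.1 hf).1
      induction f with
      | _ a b => exact I.nonneg a b (mk_mem_edges.1 this))
    (fun f hf u v h => hH.le_of_separates (mem_sdiff.1 hf).1 h)
  rw [sdiff_empty] at h
  refine h.trans (sum_le_sum_of_subset_of_nonneg (filter_subset _ _) (fun e he _ => ?_))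
  refine mul_nonneg (hx.nonneg e he) ?_
  induction e with
  | _ a b => exact I.nonneg a b (mk_mem_edges.1 he)

/-! ### Walks and cuts -/

lemma mem_edges_of_mem_walk {a b : V} (p : (⊤ : SimpleGraph V).Walk a b) {e : Sym2 V}
    (he : e ∈ p.edges) : e ∈ edges V := by
  have := p.edges_subset_edgeSet he
  simpa [edges] using this

/-- A walk crosses a cut an odd number of times exactly when the cut separates its ends. -/
lemma odd_countP_cut {a b : V} (p : (⊤ : SimpleGraph V).Walk a b) (S : Finset V) :
    Odd (p.edges.countP (· ∈ cut S)) ↔ ¬ (a ∈ S ↔ b ∈ S) := by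
  induction p with
  | nil => simp
  | @cons a c b h p ih =>
    rw [Walk.edges_cons, List.countP_cons]
    by_cases hc : s(a, c) ∈ cut S
    · rw [if_pos (by simpa using hc), Nat.odd_add_one, ih]
      rw [mk_mem_cut] at hc
      tauto
    · rw [if_neg (by simpa using hc), add_zero, ih]
      rw [mk_mem_cut] at hc
      tauto

lemma exists_mem_edges_cut {a b z : V} (p : (⊤ : SimpleGraph V).Walk a b) {S : Finset V}
    (hz : z ∈ p.support) (haz : ¬ (a ∈ S ↔ z ∈ S)) : ∃ e ∈ p.edges, e ∈ cut S := by
  have h1 := (odd_countP_cut (p.takeUntil z hz) S).2 haz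
  obtain ⟨e, he, hS⟩ := List.countP_pos_iff.1 h1.pos
  exact ⟨e, p.edges_takeUntil_subset_edges hz he, by simpa using hS⟩

/-! ### Eulerian walks -/

/-- In a multigraph whose vertices of odd degree are exactly the distinct ones among `a` and `b`, a
walk from `a` that only uses unused edges gets stuck at `b` only. -/
lemma exists_walk_le {E : Multiset (Sym2 V)} (hE : ∀ e ∈ E, e ∈ edges V) {a b : V}
    (hodd : ∀ v : V, Odd (E.countP (· ∈ cut {v})) ↔ ¬ (v = a ↔ v = b)) :
    ∃ p : (⊤ : SimpleGraph V).Walk a b, (p.edges : Multiset (Sym2 V)) ≤ E ∧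
      ((∃ e ∈ E, a ∈ e) → 0 < p.length) := by
  induction hn : E.card generalizing E a with
  | zero =>
    rw [Multiset.card_eq_zero] at hn
    subst hn
    have := hodd a
    simp at this
    subst this
    exact ⟨Walk.nil, by simp⟩
  | succ n ih =>
    by_cases hex : ∃ e ∈ E, a ∈ e
    · obtain ⟨e, he, hae⟩ := hex
      obtain ⟨c, rfl⟩ := Sym2.mem_iff_exists.1 hae
      have hac : a ≠ c := mk_mem_edges.1 (hE _ he)
      obtain ⟨p, hp, -⟩ := ih (E := E.erase s(a, c)) (a := c)
        (fun e' he' => hE e' (Multiset.mem_of_mem_erase he'))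
        (fun v => by
          have h1 := hodd v
          rw [← Multiset.cons_erase he, Multiset.countP_cons] at h1
          by_cases hv : s(a, c) ∈ cut {v}
          · rw [if_pos hv, Nat.odd_add_one] at h1
            rw [mk_mem_cut, mem_singleton, mem_singleton] at hv
            grind
          · rw [if_neg hv, add_zero] at h1
            rw [mk_mem_cut, mem_singleton, mem_singleton] at hv
            grind)
        (by rw [Multiset.card_erase_of_mem he, hn]; rfl)
      refine ⟨Walk.cons (by simpa using hac) p, ?_, fun _ => by simp⟩
      rw [Walk.edges_cons, ← Multiset.cons_coe, ← Multiset.cons_erase he]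
      exact Multiset.cons_le_cons _ (by simpa using hp)
    · have h0 : E.countP (· ∈ cut {a}) = 0 := by
        rw [Multiset.countP_eq_zero]
        exact fun e he h => hex ⟨e, he, (mem_cut_singleton.1 h).2⟩
      have := hodd a
      rw [h0] at this
      simp at this
      subst this
      exact ⟨Walk.nil, by simp, fun h => absurd h hex⟩

/-- Euler's theorem for a multigraph on `V`: connectedness is expressed by edges leaving every
proper vertex set that contains the start. -/
theorem exists_eulerian_walk {E : Multiset (Sym2 V)} (hE : ∀ e ∈ E, e ∈ edges V) {a b : V}
    (hodd : ∀ v : V, Odd (E.countP (· ∈ cut {v})) ↔ ¬ (v = a ↔ v = b))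
    (hconn : ∀ U : Finset V, a ∈ U → U ≠ univ → ∃ e ∈ E, e ∈ cut U) :
    ∃ p : (⊤ : SimpleGraph V).Walk a b, (p.edges : Multiset (Sym2 V)) = E := by
  -- A walk that misses an edge can be lengthened by splicing in a closed walk of missed edges.
  have key : ∀ n : ℕ, ∃ p : (⊤ : SimpleGraph V).Walk a b, (p.edges : Multiset (Sym2 V)) ≤ E ∧
      ((p.edges : Multiset (Sym2 V)) = E ∨ n ≤ p.length) := by
    intro n
    induction n with
    | zero =>
      obtain ⟨p, hp, -⟩ := exists_walk_le hE hodd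
      exact ⟨p, hp, Or.inr (Nat.zero_le _)⟩
    | succ n ih =>
      obtain ⟨p, hp, hpE⟩ := ih
      by_cases heq : (p.edges : Multiset (Sym2 V)) = E
      · exact ⟨p, hp, Or.inl heq⟩
      have hlen := hpE.resolve_left heq
      set R := E - (p.edges : Multiset (Sym2 V)) with hR
      have hER : (p.edges : Multiset (Sym2 V)) + R = E := add_tsub_cancel_of_le hp
      have hRE : ∀ e ∈ R, e ∈ edges V := fun e he => hE e (by rw [← hER]; simp [he])
      obtain ⟨z, hz, e, he, hze⟩ : ∃ z ∈ p.support, ∃ e ∈ R, z ∈ e := by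
        by_cases hU : p.support.toFinset = univ
        · obtain ⟨e, he⟩ := Multiset.exists_mem_of_ne_zero (s := R) (by
            intro h0; rw [h0, add_zero] at hER; exact heq hER)
          induction e with
          | _ z w =>
            exact ⟨z, by rw [← List.mem_toFinset, hU]; exact mem_univ z, _, he,
              Sym2.mem_mk_left z w⟩
        · obtain ⟨e, he, hcut⟩ := hconn p.support.toFinset (by simp) hU
          rw [← hER, Multiset.mem_add, Multiset.mem_coe] at he
          induction e with
          | _ z w =>
            rw [mk_mem_cut, List.mem_toFinset, List.mem_toFinset] at hcut
            rcases he with he | he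
            · have h1 := p.fst_mem_support_of_mem_edges he
              have h2 := p.snd_mem_support_of_mem_edges he
              tauto
            · by_cases hz : z ∈ p.support
              · exact ⟨z, hz, _, he, Sym2.mem_mk_left z w⟩
              · exact ⟨w, by tauto, _, he, Sym2.mem_mk_right z w⟩
      obtain ⟨q, hq, hqpos⟩ := exists_walk_le hRE (a := z) (b := z) (fun v => by
        have h1 := hodd v
        have h2 := odd_countP_cut p {v}
        rw [← hER, Multiset.countP_add, Multiset.coe_countP, Nat.odd_add] at h1
        simp only [mem_singleton] at h2
        rw [← Nat.not_even_iff_odd]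
        grind)
      have hqpos := hqpos ⟨e, he, hze⟩
      refine ⟨(p.takeUntil z hz).append (q.append (p.dropUntil z hz)), ?_, Or.inr ?_⟩
      · have hspec := congrArg Walk.edges (p.take_spec hz)
        rw [Walk.edges_append] at hspec
        rw [Walk.edges_append, Walk.edges_append, ← hER, ← hspec, ← Multiset.coe_add,
          ← Multiset.coe_add, ← Multiset.coe_add, add_left_comm, add_comm]
        gcongr
      · have hspec := congrArg Walk.length (p.take_spec hz)
        rw [Walk.length_append] at hspec
        rw [Walk.length_append, Walk.length_append]
        omega
  obtain ⟨p, hp, h | h⟩ := key (E.card + 1)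
  · exact ⟨p, h⟩
  · have := Multiset.card_le_card hp
    rw [Multiset.coe_card, Walk.length_edges] at this
    omega

/-! ### Shortcutting -/

/-- The cost function, set to zero on the diagonal. -/
def metric (e : Sym2 V) : ℝ := if e.IsDiag then 0 else I.c e

lemma metric_of_mem {e : Sym2 V} (he : e ∈ edges V) : I.metric e = I.c e := by
  induction e with
  | _ a b => simp [metric, mk_mem_edges.1 he]

lemma isPseudometric_metric : IsPseudometric I.metric := by
  have hnn : ∀ e, 0 ≤ I.metric e := by
    intro e
    induction e with
    | _ a b =>
      by_cases hab : a = b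
      · simp [metric, hab]
      · simpa [metric, hab] using I.nonneg a b hab
  have hdiag : ∀ v, I.metric s(v, v) = 0 := fun v => by simp [metric]
  refine ⟨hnn, hdiag, fun u v w => ?_⟩
  by_cases huv : u = v
  · subst huv; simp [hdiag]
  by_cases hvw : v = w
  · subst hvw; simp [hdiag]
  by_cases huw : u = w
  · subst huw
    rw [hdiag]
    exact add_nonneg (hnn _) (hnn _)
  simpa [metric, huv, hvw, huw] using I.triangle u v w huv hvw huw

/-- The total distance between consecutive members of a list. -/
def pathLength (D : Sym2 V → ℝ) : List V → ℝ
  | [] => 0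
  | [_] => 0
  | a :: b :: l => D s(a, b) + pathLength D (b :: l)

lemma walkCost_eq_pathLength {a b : V} (p : (⊤ : SimpleGraph V).Walk a b) :
    (p.edges.map I.c).sum = pathLength I.metric p.support := by
  induction p with
  | nil => simp [pathLength]
  | @cons a c b h p ih =>
    rw [Walk.edges_cons, List.map_cons, List.sum_cons, ih, Walk.support_cons]
    conv_rhs => rw [← Walk.cons_tail_support, pathLength, Walk.cons_tail_support]
    rw [metric_of_mem I (mk_mem_edges.2 (by simpa using h))]

lemma add_pathLength_le {D : Sym2 V → ℝ} (hD : IsPseudometric D) {c b : V} {l₁ l₂ : List V}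
    (h : List.Sublist (b :: l₁) (c :: l₂)) :
    D s(c, b) + pathLength D (b :: l₁) ≤ pathLength D (c :: l₂) := by
  induction l₂ generalizing c b l₁ with
  | nil =>
    have h1 := List.Sublist.eq_of_length_le h (by simp)
    rw [List.cons.injEq] at h1
    rw [h1.1, h1.2, hD.diag, zero_add]
  | cons c' l₂ ih =>
    rw [pathLength]
    rcases List.sublist_cons_iff.1 h with h' | ⟨r, hr, h'⟩
    · have h1 := ih h'
      have h2 := hD.triangle c c' b
      linarith
    · rw [List.cons.injEq] at hr
      obtain ⟨rfl, rfl⟩ := hr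
      rw [hD.diag, zero_add]
      cases l₁ with
      | nil =>
        have h1 := ih (c := c') (b := c') (l₁ := []) (by simp)
        rw [hD.diag, zero_add] at h1
        have h2 := hD.nonneg s(b, c')
        rw [pathLength] at h1 ⊢
        linarith
      | cons b' l₁ =>
        have h1 := ih h'
        have h2 := hD.triangle b c' b'
        rw [pathLength]
        linarith

variable {I} in
lemma IsHamiltonianShortcut.walkCost_le {p q : I.STWalk} (h : I.IsHamiltonianShortcut p q) :
    I.walkCost q ≤ I.walkCost p := by
  rw [walkCost, walkCost, walkCost_eq_pathLength, walkCost_eq_pathLength]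
  have h1 := h.2
  rw [← q.cons_tail_support, ← p.cons_tail_support] at h1 ⊢
  have h2 := add_pathLength_le I.isPseudometric_metric h1
  rwa [I.isPseudometric_metric.diag, zero_add] at h2

lemma exists_support_eq_cons_append {a b : V} (p : (⊤ : SimpleGraph V).Walk a b) (hab : a ≠ b) :
    ∃ m, p.support = a :: (m ++ [b]) := by
  cases p with
  | nil => exact absurd rfl hab
  | cons h p =>
    have h1 := List.dropLast_append_getLast p.support_ne_nil
    rw [p.getLast_support] at h1
    exact ⟨p.support.dropLast, by rw [h1, Walk.support_cons]⟩

lemma exists_isHamiltonianShortcut {p : I.STWalk} (hp : ∀ v, v ∈ p.support) :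
    ∃ q, I.IsHamiltonianShortcut p q := by
  have hst := I.s_ne_t
  obtain ⟨m, hm⟩ := exists_support_eq_cons_append p hst
  -- Keep the first occurrence of every inner vertex.
  set m' := (m.filter (fun v => v ≠ I.s ∧ v ≠ I.t)).dedup with hm'
  have hmem : ∀ v, v ∈ m' ↔ v ∈ m ∧ v ≠ I.s ∧ v ≠ I.t := fun v => by simp [hm']
  set L := I.s :: (m' ++ [I.t]) with hL
  have hnodup : L.Nodup := by
    rw [hL, List.nodup_cons, List.nodup_append]
    refine ⟨?_, List.nodup_dedup _, by simp, ?_⟩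
    · simp [hmem, hst]
    · intro a ha b hb
      rw [List.mem_singleton] at hb
      subst hb
      exact ((hmem a).1 ha).2.2
  have hsub : List.Sublist L p.support := by
    rw [hm]
    exact ((((List.dedup_sublist _).trans List.filter_sublist).append_right _).cons_cons _)
  have hchain : L.IsChain (⊤ : SimpleGraph V).Adj :=
    (List.Pairwise.imp (fun h => by simpa using h) hnodup).isChain
  have hLne : L ≠ [] := by simp [hL]
  let q : I.STWalk := (Walk.ofSupport L hLne hchain).copy (by simp [hL]) (by simp [hL])
  have hq : q.support = L := by
    rw [Walk.support_copy, Walk.support_ofSupport]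
  refine ⟨q, ?_, by rw [hq]; exact hsub⟩
  rw [Walk.IsPath.isHamiltonian_iff (by rw [Walk.isPath_def, hq]; exact hnodup)]
  intro v
  have hv := hp v
  rw [hm] at hv
  rw [hq, hL]
  simp only [List.mem_cons, List.mem_append, List.not_mem_nil, or_false, hmem] at hv ⊢
  tauto

/-! ### Carrying out the algorithm -/

lemma countP_cut_singleton {F : Finset (Sym2 V)} (hF : F ⊆ edges V) (v : V) :
    F.val.countP (· ∈ cut {v}) = deg F v := by
  rw [deg, card_def, filter_val, ← Multiset.countP_eq_card_filter]
  exact Multiset.countP_congr rfl (fun e he => by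
    simp [mem_cut_singleton, hF (by exact he)])

lemma IsPerfectMatchingOn.deg_eq {T : Finset V} {M : Finset (Sym2 V)}
    (h : IsPerfectMatchingOn T M) (v : V) : deg M v = if v ∈ T then 1 else 0 := by
  split_ifs with hv
  · obtain ⟨e, ⟨he, hve⟩, hu⟩ := h.2.2 v hv
    rw [deg, card_eq_one]
    refine ⟨e, ?_⟩
    ext e'
    rw [mem_filter, mem_singleton]
    exact ⟨fun h' => hu e' h', fun h' => h' ▸ ⟨he, hve⟩⟩
  · rw [deg, card_eq_zero, filter_eq_empty_iff]
    exact fun e he hve => hv (h.2.1 e he v hve)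

lemma mem_wrongParity {H : Finset (Sym2 V)} {v : V} :
    v ∈ I.wrongParity H ↔ (Odd (deg H v) ↔ (v = I.s ↔ v = I.t)) := by
  have hst := I.s_ne_t
  rw [wrongParity, mem_filter, ← Nat.not_odd_iff_even]
  simp only [mem_univ, true_and]
  grind

/-- The parity of the number of wrong vertices in `S`. -/
lemma odd_card_inter_wrongParity {H : Finset (Sym2 V)} (hH : H ⊆ edges V) (S : Finset V) :
    Odd (S ∩ I.wrongParity H).card ↔
      ¬ (Odd (H ∩ cut S).card ↔ Odd (({I.s, I.t} : Finset V) ∩ S).card) := by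
  have h1 : (S ∩ I.wrongParity H).card ≡
      (∑ v ∈ S, deg H v) + (({I.s, I.t} : Finset V) ∩ S).card [MOD 2] := by
    have e1 : (({I.s, I.t} : Finset V) ∩ S).card =
        ∑ v ∈ S, if v ∈ ({I.s, I.t} : Finset V) then 1 else 0 := by
      rw [← card_filter, filter_mem_eq_inter, inter_comm]
    have e2 : (S ∩ I.wrongParity H).card = ∑ v ∈ S, if v ∈ I.wrongParity H then 1 else 0 := by
      rw [← card_filter, filter_mem_eq_inter]
    rw [e1, e2, ← sum_add_distrib]
    refine Nat.ModEq.sum (fun v _ => ?_)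
    have hst := I.s_ne_t
    have h2 := I.mem_wrongParity (H := H) (v := v)
    rw [Nat.odd_iff] at h2
    simp only [mem_insert, mem_singleton, Nat.ModEq]
    split_ifs <;> grind
  have h2 := h1.trans ((sum_deg_mod_two hH S).add_right _)
  rw [Nat.odd_iff, h2, ← Nat.odd_iff, Nat.odd_add, ← Nat.not_odd_iff_even]
  tauto

lemma even_card_wrongParity {H : Finset (Sym2 V)} (hH : H ⊆ edges V) :
    Even (I.wrongParity H).card := by
  have h := I.odd_card_inter_wrongParity hH univ
  rw [univ_inter, cut_univ, inter_empty, inter_univ, card_pair I.s_ne_t] at h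
  rw [← Nat.not_odd_iff_even, h]
  simp

lemma exists_isMinSpanningTree : ∃ H, I.IsMinSpanningTree H := by
  classical
  have : Nonempty V := ⟨I.s⟩
  obtain ⟨T, -, hT⟩ := (connected_top (V := V)).exists_isTree_le
  have hne : (univ.filter (fun H : Finset (Sym2 V) => IsSpanningTree H)).Nonempty := by
    refine ⟨T.edgeFinset, ?_⟩
    rw [mem_filter]
    refine ⟨mem_univ _, ?_, ?_⟩
    · intro e he
      rw [mem_edgeFinset] at he
      induction e with
      | _ a b => exact mk_mem_edges.2 (T.ne_of_adj he)
    · rwa [coe_edgeFinset, fromEdgeSet_edgeSet]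
  obtain ⟨H, hH, hmin⟩ := exists_min_image _ I.setCost hne
  exact ⟨H, (mem_filter.1 hH).2, fun H' hH' => hmin H' (mem_filter.2 ⟨mem_univ _, hH'⟩)⟩

lemma exists_isMinMatchingOn {T : Finset V} (hT : Even T.card) : ∃ M, I.IsMinMatchingOn T M := by
  classical
  obtain ⟨M₀, hM₀⟩ := exists_isPerfectMatchingOn hT
  obtain ⟨M, hM, hmin⟩ := exists_min_image
    (univ.filter (fun M : Finset (Sym2 V) => IsPerfectMatchingOn T M)) I.setCost
    ⟨M₀, mem_filter.2 ⟨mem_univ _, hM₀⟩⟩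
  exact ⟨M, (mem_filter.1 hM).2, fun M' hM' => hmin M' (mem_filter.2 ⟨mem_univ _, hM'⟩)⟩

lemma exists_isEulerianPathOf {H M : Finset (Sym2 V)} (hH : IsSpanningTree H)
    (hM : IsPerfectMatchingOn (I.wrongParity H) M) : ∃ p, I.IsEulerianPathOf H M p := by
  refine exists_eulerian_walk ?_ (fun v => ?_) (fun U hs hU => ?_)
  · intro e he
    rcases Multiset.mem_add.1 he with he | he
    · exact hH.1 he
    · exact hM.1 he
  · rw [Multiset.countP_add, countP_cut_singleton hH.1, countP_cut_singleton hM.1, hM.deg_eq]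
    have h := I.mem_wrongParity (H := H) (v := v)
    split_ifs with hv
    · rw [Nat.odd_add_one]
      tauto
    · rw [add_zero]
      tauto
  · obtain ⟨b, hb⟩ : ∃ b, b ∉ U := by
      by_contra! h
      exact hU (eq_univ_of_forall h)
    obtain ⟨e, he, hcut⟩ := hH.exists_mem_cut hs hb
    exact ⟨e, Multiset.mem_add.2 (Or.inl he), hcut⟩

variable {I} in
lemma IsEulerianPathOf.mem_support {H M : Finset (Sym2 V)} {p : I.STWalk}
    (hp : I.IsEulerianPathOf H M p) (hH : IsSpanningTree H) (v : V) : v ∈ p.support := by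
  obtain ⟨w, hw⟩ : ∃ w, w ≠ v := by
    by_cases h : I.s = v
    · exact ⟨I.t, h ▸ I.s_ne_t.symm⟩
    · exact ⟨I.s, h⟩
  obtain ⟨e, he, hcut⟩ := hH.exists_mem_cut (mem_singleton_self v) (by simpa using hw)
  have hve := (mem_cut_singleton.1 hcut).2
  have hep : e ∈ (p.edges : Multiset (Sym2 V)) := by
    rw [show (p.edges : Multiset (Sym2 V)) = H.val + M.val from hp]
    exact Multiset.mem_add.2 (Or.inl he)
  obtain ⟨b, rfl⟩ := Sym2.mem_iff_exists.1 hve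
  exact p.fst_mem_support_of_mem_edges (by simpa using hep)

lemma hoogeveenNeverStuck : I.HoogeveenNeverStuck :=
  ⟨I.exists_isMinSpanningTree,
    fun _ hH => I.exists_isMinMatchingOn (I.even_card_wrongParity hH.1.1),
    fun _ _ hH hM => I.exists_isEulerianPathOf hH.1 hM.1,
    fun _ _ _ hH _ hp => I.exists_isHamiltonianShortcut (fun v => hp.mem_support hH.1 v)⟩

lemma exists_hoogeveenOutput : ∃ q, I.HoogeveenOutput q := by
  obtain ⟨h1, h2, h3, h4⟩ := I.hoogeveenNeverStuck
  obtain ⟨H, hH⟩ := h1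
  obtain ⟨M, hM⟩ := h2 H hH
  obtain ⟨p, hp⟩ := h3 H M hH hM
  obtain ⟨q, hq⟩ := h4 H M p hH hM hp
  exact ⟨q, H, M, p, hH, hM, hp, hq⟩

/-! ### The approximation guarantee -/

variable {I} in
/-- A third of the tree plus a third of a feasible solution dominates the wrong-parity matching:
a cut splitting the wrong vertices oddly contains at least two tree edges if it separates `s` from
`t`, by parity, and otherwise has value at least two in the relaxation. -/
lemma IsMinMatchingOn.three_mul_setCost_le {H M : Finset (Sym2 V)} (hH : IsSpanningTree H)
    (hM : I.IsMinMatchingOn (I.wrongParity H) M) {x : Sym2 V → ℝ} (hx : I.HKFeasible x) :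
    3 * I.setCost M ≤ I.setCost H + I.lpCost x := by
  have hT := I.even_card_wrongParity hH.1
  let y : Sym2 V → ℝ := fun e => ((if e ∈ H then 1 else 0) + x e) / 3
  have hysum : ∀ S : Finset V, ∑ e ∈ cut S, y e =
      (((H ∩ cut S).card : ℝ) + ∑ e ∈ cut S, x e) / 3 := by
    intro S
    rw [← sum_div, sum_add_distrib, ← sum_filter, filter_mem_eq_inter, sum_const, nsmul_eq_mul,
      mul_one, inter_comm]
  have hnn : ∀ e ∈ edges V, 0 ≤ y e := fun e he => by
    have := hx.nonneg e he
    simp only [y]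
    positivity
  have hcut : ∀ S : Finset V, Odd (S ∩ I.wrongParity H).card → 1 ≤ ∑ e ∈ cut S, y e := by
    intro S hS
    have hSu : S ≠ univ := by
      rintro rfl
      rw [univ_inter, ← Nat.not_even_iff_odd] at hS
      exact hS hT
    have hSe : S ≠ ∅ := by rintro rfl; simp at hS
    have hpar := (I.odd_card_inter_wrongParity hH.1 S).1 hS
    obtain ⟨a, ha⟩ := nonempty_iff_ne_empty.2 hSe
    obtain ⟨b, hb⟩ : ∃ b, b ∉ S := by
      by_contra! h
      exact hSu (eq_univ_of_forall h)
    obtain ⟨e, he, hecut⟩ := hH.exists_mem_cut ha hb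
    have hpos : 0 < (H ∩ cut S).card := card_pos.2 ⟨e, mem_inter.2 ⟨he, hecut⟩⟩
    rw [hysum, le_div_iff₀ (by norm_num)]
    by_cases h1 : (({I.s, I.t} : Finset V) ∩ S).card = 1
    · have hx1 := hx.cut_one S hSu h1
      have : 2 ≤ (H ∩ cut S).card := by
        by_contra! hlt
        have h2 : (H ∩ cut S).card = 1 := by omega
        rw [h1, h2] at hpar
        exact hpar Iff.rfl
      have : (2 : ℝ) ≤ (H ∩ cut S).card := by exact_mod_cast this
      linarith
    · have hx2 := hx.cut_two S hSu h1 hSe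
      have : (1 : ℝ) ≤ (H ∩ cut S).card := by exact_mod_cast hpos
      linarith
  obtain ⟨M', hM', hle⟩ := exists_matching_le I.isPseudometric_metric hT hnn hcut
  have h1 := hM.2 M' hM'
  have h2 : ∑ e ∈ M', I.metric e = I.setCost M' :=
    sum_congr rfl (fun e he => I.metric_of_mem (hM'.1 he))
  have h3 : ∑ e ∈ edges V, y e * I.metric e = (I.setCost H + I.lpCost x) / 3 := by
    have e1 : I.setCost H = ∑ e ∈ edges V, if e ∈ H then I.c e else 0 := by
      rw [← sum_filter, filter_mem_eq_inter, inter_eq_right.2 hH.1, setCost]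
    rw [e1, lpCost, ← sum_add_distrib, sum_div]
    refine sum_congr rfl (fun e he => ?_)
    rw [I.metric_of_mem he]
    simp only [y]
    split_ifs <;> ring
  linarith

variable {I} in
lemma IsEulerianPathOf.walkCost_eq {H M : Finset (Sym2 V)} {p : I.STWalk}
    (hp : I.IsEulerianPathOf H M p) : I.walkCost p = I.setCost H + I.setCost M := by
  have h1 : I.walkCost p = ((p.edges : Multiset (Sym2 V)).map I.c).sum := by
    simp [walkCost]
  rw [h1, show (p.edges : Multiset (Sym2 V)) = H.val + M.val from hp, Multiset.map_add,
    Multiset.sum_add]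
  rfl

variable {I} in
theorem HoogeveenOutput.walkCost_le {q : I.STWalk} (hq : I.HoogeveenOutput q) {x : Sym2 V → ℝ}
    (hx : I.HKFeasible x) : I.walkCost q ≤ 5 / 3 * I.lpCost x := by
  obtain ⟨H, M, p, hH, hM, hp, hs⟩ := hq
  have h1 := hs.walkCost_le
  rw [hp.walkCost_eq] at h1
  have h2 := hH.setCost_le hx
  have h3 := hM.three_mul_setCost_le hH.1 hx
  linarith

/-! ### Hamiltonian paths in the relaxation, and its optimum -/

lemma sum_countP_cut_singleton {E : Multiset (Sym2 V)} (hE : ∀ e ∈ E, e ∈ edges V) :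
    ∑ v : V, E.countP (· ∈ cut {v}) = 2 * E.card := by
  induction E using Multiset.induction_on with
  | empty => simp
  | cons e E ih =>
    have he : e ∈ edges V := hE e (Multiset.mem_cons_self e E)
    simp only [Multiset.countP_cons, sum_add_distrib, Multiset.card_cons]
    rw [ih (fun e' he' => hE e' (Multiset.mem_cons_of_mem he')), mul_add, ← card_filter]
    congr 1
    induction e with
    | _ a b =>
      have : univ.filter (fun v => s(a, b) ∈ cut {v}) = {a, b} := by
        ext v
        simp [mem_cut_singleton, he]
      rw [this, card_pair (mk_mem_edges.1 he)]

/-- The incidence vector of a walk without repeated edges. -/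
def incidence (q : I.STWalk) (e : Sym2 V) : ℝ := if e ∈ q.edges then 1 else 0

variable {I} in
lemma sum_incidence_cut {q : I.STWalk} (hq : q.IsHamiltonian) (S : Finset V) :
    ∑ e ∈ cut S, incidence I q e = q.edges.countP (· ∈ cut S) := by
  have hnd : q.edges.Nodup := hq.isPath.isTrail.edges_nodup
  have h1 : ∑ e ∈ cut S, incidence I q e = ((cut S ∩ q.edges.toFinset).card : ℝ) := by
    rw [← filter_mem_eq_inter, card_filter, Nat.cast_sum]
    refine sum_congr rfl (fun e _ => ?_)
    simp [incidence]
  rw [h1, List.countP_eq_length_filter, ← List.toFinset_card_of_nodup (hnd.filter _)]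
  congr 2
  ext e
  simp [and_comm]

variable {I} in
lemma lpCost_incidence {q : I.STWalk} (hq : q.IsHamiltonian) :
    I.lpCost (incidence I q) = I.walkCost q := by
  have hnd : q.edges.Nodup := hq.isPath.isTrail.edges_nodup
  rw [lpCost, walkCost, ← List.sum_toFinset _ hnd]
  have h1 : q.edges.toFinset = (edges V).filter (· ∈ q.edges) := by
    ext e
    simp only [List.mem_toFinset, mem_filter]
    exact ⟨fun h => ⟨mem_edges_of_mem_walk q h, h⟩, fun h => h.2⟩
  rw [h1, sum_filter]
  refine sum_congr rfl (fun e _ => ?_)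
  simp [incidence]

variable {I} in
theorem hkFeasible_incidence {q : I.STWalk} (hq : q.IsHamiltonian) :
    I.HKFeasible (incidence I q) := by
  have hst := I.s_ne_t
  set N : Finset V → ℕ := fun S => q.edges.countP (· ∈ cut S) with hN
  have hodd : ∀ S, Odd (N S) ↔ ¬ (I.s ∈ S ↔ I.t ∈ S) := odd_countP_cut q
  have hsum : ∀ S, ∑ e ∈ cut S, incidence I q e = N S := sum_incidence_cut hq
  have hpos : ∀ S, S ≠ univ → S ≠ ∅ → 0 < N S := by
    intro S hSu hSe
    obtain ⟨a, ha⟩ := nonempty_iff_ne_empty.2 hSe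
    obtain ⟨b, hb⟩ : ∃ b, b ∉ S := by
      by_contra! h
      exact hSu (eq_univ_of_forall h)
    obtain ⟨z, hz⟩ : ∃ z, ¬ (I.s ∈ S ↔ z ∈ S) := by
      by_cases hs : I.s ∈ S
      · exact ⟨b, by tauto⟩
      · exact ⟨a, by tauto⟩
    obtain ⟨e, he, hcut⟩ := exists_mem_edges_cut q (hq.mem_support z) hz
    exact List.countP_pos_iff.2 ⟨e, he, by simpa using hcut⟩
  have hsep : ∀ S : Finset V, (({I.s, I.t} : Finset V) ∩ S).card = 1 ↔
      ¬ (I.s ∈ S ↔ I.t ∈ S) := by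
    intro S
    by_cases hs : I.s ∈ S <;> by_cases ht : I.t ∈ S <;>
      simp [hs, ht, hst, insert_inter_of_mem, insert_inter_of_notMem, singleton_inter_of_mem,
        singleton_inter_of_notMem]
  have htwo : ∀ S : Finset V, S ≠ univ → (({I.s, I.t} : Finset V) ∩ S).card ≠ 1 → S ≠ ∅ →
      2 ≤ N S := by
    intro S hSu h1 hSe
    have h2 := hpos S hSu hSe
    have h3 : ¬ Odd (N S) := by rw [hodd, ← hsep]; exact h1
    by_contra! hlt
    have : N S = 1 := by omega
    rw [this] at h3
    exact h3 odd_one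
  have hsingle : ∀ v : V, ({v} : Finset V) ≠ univ := by
    intro v h
    have h1 : I.s ∈ ({v} : Finset V) := h ▸ mem_univ _
    have h2 : I.t ∈ ({v} : Finset V) := h ▸ mem_univ _
    rw [mem_singleton] at h1 h2
    exact hst (h1.trans h2.symm)
  -- The degrees are at least the prescribed ones, and both have sum `2 (|V| - 1)`.
  have hle : ∀ v ∈ (univ : Finset V),
      2 ≤ N {v} + ((if v = I.s then 1 else 0) + (if v = I.t then 1 else 0)) := by
    intro v _
    have h1 := hpos {v} (hsingle v) (singleton_ne_empty v)
    have h2 := htwo {v} (hsingle v)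
    have h3 := hsep {v}
    rw [mem_singleton, mem_singleton] at h3
    split_ifs with hs ht ht
    · omega
    · omega
    · omega
    · have := h2 (by rw [ne_eq, h3]; grind) (singleton_ne_empty v)
      omega
  have htotal : ∑ v : V, 2 =
      ∑ v : V, (N {v} + ((if v = I.s then 1 else 0) + (if v = I.t then 1 else 0))) := by
    have h1 := sum_countP_cut_singleton (E := (q.edges : Multiset (Sym2 V)))
      (fun e he => mem_edges_of_mem_walk q (by simpa using he))
    simp only [Multiset.coe_countP, Multiset.coe_card, Walk.length_edges] at h1
    have h2 := hq.length_eq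
    have h3 : 0 < Fintype.card V := Fintype.card_pos_iff.2 ⟨I.s⟩
    rw [sum_add_distrib, sum_add_distrib, h1]
    simp only [sum_const, card_univ, smul_eq_mul, sum_ite_eq', mem_univ, if_true]
    omega
  have heq := (sum_eq_sum_iff_of_le hle).1 htotal
  refine ⟨?_, ?_, ?_, ?_, ?_, ?_⟩
  · intro S hSu h1
    rw [hsum]
    have : 0 < N S := hpos S hSu (by rintro rfl; simp at h1)
    exact_mod_cast this
  · intro S hSu h1 hSe
    rw [hsum]
    exact_mod_cast htwo S hSu h1 hSe
  · have h := heq I.s (mem_univ _)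
    rw [if_pos rfl, if_neg hst] at h
    rw [hsum]
    exact_mod_cast (by omega : N {I.s} = 1)
  · have h := heq I.t (mem_univ _)
    rw [if_pos rfl, if_neg hst.symm] at h
    rw [hsum]
    exact_mod_cast (by omega : N {I.t} = 1)
  · intro v hvs hvt
    have h := heq v (mem_univ _)
    rw [if_neg hvs, if_neg hvt] at h
    rw [hsum]
    exact_mod_cast (by omega : N {v} = 2)
  · intro e _
    rw [incidence]
    split_ifs <;> norm_num

variable {I} in
lemma HKFeasible.congr {x y : Sym2 V → ℝ} (hx : I.HKFeasible x) (h : ∀ e ∈ edges V, x e = y e) :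
    I.HKFeasible y := by
  have hc : ∀ S : Finset V, ∑ e ∈ cut S, y e = ∑ e ∈ cut S, x e := fun S =>
    sum_congr rfl (fun e he => (h e (cut_subset_edges S he)).symm)
  obtain ⟨h1, h2, h3, h4, h5, h6⟩ := hx
  exact ⟨by simpa only [hc] using h1, by simpa only [hc] using h2, by rw [hc, h3],
    by rw [hc, h4], by simpa only [hc] using h5, fun e he => h e he ▸ h6 e he⟩

variable {I} in
lemma HKFeasible.le_two {x : Sym2 V → ℝ} (hx : I.HKFeasible x) {e : Sym2 V} (he : e ∈ edges V) :
    x e ≤ 2 := by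
  induction e with
  | _ a b =>
    have h1 : x s(a, b) ≤ ∑ e ∈ cut {a}, x e :=
      single_le_sum (fun e he => hx.nonneg e (cut_subset_edges _ he))
        (mem_cut_singleton.2 ⟨he, Sym2.mem_mk_left a b⟩)
    by_cases hs : a = I.s
    · rw [hs, hx.deg_s, ← hs] at h1; linarith
    by_cases ht : a = I.t
    · rw [ht, hx.deg_t, ← ht] at h1; linarith
    · rwa [hx.deg_internal a hs ht] at h1

theorem exists_isHKOptimal : ∃ x, I.IsHKOptimal x := by
  -- Coordinates outside the edge set are unconstrained; they are fixed to zero for compactness.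
  let K : Set (Sym2 V → ℝ) := {x | I.HKFeasible x ∧ ∀ e, e ∉ edges V → x e = 0}
  have hrestrict : ∀ x, I.HKFeasible x → ∃ y ∈ K, I.lpCost y = I.lpCost x := by
    intro x hx
    refine ⟨fun e => if e ∈ edges V then x e else 0,
      ⟨hx.congr (fun e he => by simp [he]), fun e he => by simp [he]⟩, ?_⟩
    exact sum_congr rfl (fun e he => by simp [he])
  have hclosed : IsClosed K := by
    have : K = {x | ∀ S : Finset V, S ≠ univ → (({I.s, I.t} : Finset V) ∩ S).card = 1 →
          1 ≤ ∑ e ∈ cut S, x e} ∩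
        {x | ∀ S : Finset V, S ≠ univ → (({I.s, I.t} : Finset V) ∩ S).card ≠ 1 → S ≠ ∅ →
          2 ≤ ∑ e ∈ cut S, x e} ∩
        {x | ∑ e ∈ cut {I.s}, x e = 1} ∩ {x | ∑ e ∈ cut {I.t}, x e = 1} ∩
        {x | ∀ v : V, v ≠ I.s → v ≠ I.t → ∑ e ∈ cut {v}, x e = 2} ∩
        {x | ∀ e ∈ edges V, 0 ≤ x e} ∩ {x | ∀ e, e ∉ edges V → x e = 0} := by
      ext x
      constructor
      · rintro ⟨⟨h1, h2, h3, h4, h5, h6⟩, h7⟩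
        exact ⟨⟨⟨⟨⟨⟨h1, h2⟩, h3⟩, h4⟩, h5⟩, h6⟩, h7⟩
      · rintro ⟨⟨⟨⟨⟨⟨h1, h2⟩, h3⟩, h4⟩, h5⟩, h6⟩, h7⟩
        exact ⟨⟨h1, h2, h3, h4, h5, h6⟩, h7⟩
    rw [this]
    simp only [Set.ofPred_forall]
    refine ((((((?_ : IsClosed _).inter ?_).inter ?_).inter ?_).inter ?_).inter ?_).inter ?_
    · exact isClosed_iInter fun S => isClosed_iInter fun _ => isClosed_iInter fun _ =>
        isClosed_le (by fun_prop) (by fun_prop)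
    · exact isClosed_iInter fun S => isClosed_iInter fun _ => isClosed_iInter fun _ =>
        isClosed_iInter fun _ => isClosed_le (by fun_prop) (by fun_prop)
    · exact isClosed_eq (by fun_prop) (by fun_prop)
    · exact isClosed_eq (by fun_prop) (by fun_prop)
    · exact isClosed_iInter fun v => isClosed_iInter fun _ => isClosed_iInter fun _ =>
        isClosed_eq (by fun_prop) (by fun_prop)
    · exact isClosed_iInter fun e => isClosed_iInter fun _ =>
        isClosed_le (by fun_prop) (by fun_prop)
    · exact isClosed_iInter fun e => isClosed_iInter fun _ =>
        isClosed_eq (by fun_prop) (by fun_prop)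
  have hcompact : IsCompact K :=
    (isCompact_univ_pi (fun _ : Sym2 V => isCompact_Icc (a := (0 : ℝ)) (b := 2))).of_isClosed_subset
      hclosed (fun x hx e _ => by
        by_cases he : e ∈ edges V
        · exact ⟨hx.1.nonneg e he, hx.1.le_two he⟩
        · rw [hx.2 e he]; norm_num)
  obtain ⟨q, H, M, p, -, -, -, hq⟩ := I.exists_hoogeveenOutput
  obtain ⟨x₀, hx₀, -⟩ := hrestrict _ (hkFeasible_incidence hq.1)
  obtain ⟨x, hx, hmin⟩ := hcompact.exists_isMinOn ⟨x₀, hx₀⟩ (f := I.lpCost)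
    (by unfold lpCost; fun_prop)
  refine ⟨x, hx.1, fun y hy => ?_⟩
  obtain ⟨y', hy', hc⟩ := hrestrict y hy
  rw [← hc]
  exact hmin hy'

variable {I} in
lemma IsHKOptimal.hkValue_eq {x : Sym2 V → ℝ} (hx : I.IsHKOptimal x) : I.hkValue = I.lpCost x :=
  IsLeast.csInf_eq ⟨⟨x, hx.1, rfl⟩, by rintro _ ⟨y, hy, rfl⟩; exact hx.2 y hy⟩

lemma walkCost_nonneg (q : I.STWalk) : 0 ≤ I.walkCost q := by
  refine List.sum_nonneg (fun r hr => ?_)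
  obtain ⟨e, he, rfl⟩ := List.mem_map.1 hr
  rw [← I.metric_of_mem (mem_edges_of_mem_walk q he)]
  exact I.isPseudometric_metric.nonneg e

variable {I} in
lemma opt_le_walkCost {q : I.STWalk} (hq : q.IsHamiltonian) : I.opt ≤ I.walkCost q :=
  csInf_le ⟨0, by rintro _ ⟨p, -, rfl⟩; exact I.walkCost_nonneg p⟩ ⟨q, hq, rfl⟩

variable {I} in
lemma HoogeveenOutput.isHamiltonian {q : I.STWalk} (hq : I.HoogeveenOutput q) :
    q.IsHamiltonian := by
  obtain ⟨_, _, _, _, _, _, hs⟩ := hq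
  exact hs.1

variable {I} in
lemma HoogeveenOutput.walkCost_le_opt {q : I.STWalk} (hq : I.HoogeveenOutput q) :
    I.walkCost q ≤ 5 / 3 * I.opt := by
  have h : 3 / 5 * I.walkCost q ≤ I.opt := by
    refine le_csInf ⟨_, q, hq.isHamiltonian, rfl⟩ ?_
    rintro _ ⟨p, hp, rfl⟩
    have := hq.walkCost_le (hkFeasible_incidence hp)
    rw [lpCost_incidence hp] at this
    linarith
  linarith

lemma opt_le_hkValue : I.opt ≤ 5 / 3 * I.hkValue := by
  obtain ⟨x, hx⟩ := I.exists_isHKOptimal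
  obtain ⟨q, hq⟩ := I.exists_hoogeveenOutput
  rw [hx.hkValue_eq]
  exact (opt_le_walkCost hq.isHamiltonian).trans (hq.walkCost_le hx.1)

end PathTSP

theorem theoremt :
    (∀ (V : Type u) [Fintype V] [DecidableEq V] (I : PathTSP V),
      I.HoogeveenNeverStuck ∧
      (∃ x, I.IsHKOptimal x) ∧
      (∀ q, I.HoogeveenOutput q → q.IsHamiltonian ∧
        ∀ x, I.IsHKOptimal x → I.walkCost q ≤ 5 / 3 * I.lpCost x)) ∧
    IsApproximation.{u} (5 / 3) (fun _ _ _ I q => I.HoogeveenOutput q) ∧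
    hkIntegralityGap ≤ 5 / 3 := by
  refine ⟨fun V _ _ I => ⟨I.hoogeveenNeverStuck, I.exists_isHKOptimal,
    fun q hq => ⟨hq.isHamiltonian, fun x hx => hq.walkCost_le hx.1⟩⟩,
    fun V _ _ I => ⟨I.exists_hoogeveenOutput,
      fun q hq => ⟨hq.isHamiltonian, hq.walkCost_le_opt⟩⟩, ?_⟩
  refine iSup_le fun n => iSup_le fun I => ENNReal.div_le_of_le_mul ?_
  have h : (5 / 3 : ENNReal) = ENNReal.ofReal (5 / 3) := by
    rw [ENNReal.ofReal_div_of_pos (by norm_num)]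
    norm_num
  rw [h, ← ENNReal.ofReal_mul (by norm_num)]
  exact ENNReal.ofReal_le_ofReal I.opt_le_hkValue
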